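/- Let $n\ge 1$, $1<p<\infty$, $1<r<\infty$ and $s>0$. Write $\widehat f(\xi)=\int_{\mathbb R^n} f(x)e^{-2\pi i x\cdot\xi}\,dx$, and for $\sigma\in L^\infty(\mathbb R^n)$ and a Schwartz function $f$ let $$T_\sigma f(x)=\int_{\mathbb R^n}\widehat f(\xi)\,\sigma(\xi)\,e^{2\pi i x\cdot\xi}\,d\xi .$$ Let $\|T_\sigma\|_{L^p\to L^p}\in[0,\infty]$ be the least constant $c$ with $\|T_\sigma f\|_{L^p}\le c\,\|f\|_{L^p}$ for all Schwartz functions $f$. Let $\|h\|_{L^r_s}=\|(I-\Delta)^{s/2}h\|_{L^r}$ be the Sobolev norm, where $(I-\Delta)^{s/2}$ is the operator with Fourier symbol $(1+4\pi^2|\xi|^2)^{s/2}$. Let $\Psi$ be a Schwartz function on $\mathbb R^n$ whose Fourier transform vanishes outside the annulus $\{1/2<|\xi|<2\}$ and satisfies $\sum_{j\in\mathbb Z}\widehat\Psi(2^{-j}\xi)=1$ for all $\xi\ne 0$. Suppose that there is a finite constant $C$ such that $$\|T_\sigma\|_{L^p(\mathbb R^n)\to L^p(\mathbb R^n)}\le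 C\,\sup_{k\in\mathbb Z}\big\|\sigma(2^k\cdot)\widehat\Psi\big\|_{L^r_s(\mathbb R^n)}$$ for every $\sigma\in L^\infty(\mathbb R^n)$ for which the supremum on the right is finite. Then necessarily $$rs\ge n\qquad\text{and}\qquad\Big|\frac1p-\frac12\Big|\le\frac sn .$$ -/

import Mathlib

open scoped ENNReal NNReal SchwartzMap FourierTransform
open MeasureTheory

/-- The symbol `(1 + 4π²|ξ|²)^{s/2}` of the operator `(I - Δ)^{s/2}`, for the Fourier transform
`f̂(ξ) = ∫ f(x) e^{-2πi x·ξ} dx` (the normalization of `𝓕` in Mathlib). -/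
noncomputable def besselSymbol {n : ℕ} (s : ℝ) (ξ : EuclideanSpace ℝ (Fin n)) : ℂ :=
  (((1 + 4 * Real.pi ^ 2 * ‖ξ‖ ^ 2) ^ (s / 2) : ℝ) : ℂ)

/-- The symbol has temperate growth, so that Mathlib's Fourier multiplier operator with this symbol
is the genuine one (it is `0` by convention for symbols that are not of temperate growth). -/
theorem besselSymbol_hasTemperateGrowth {n : ℕ} (s : ℝ) :
    (besselSymbol (n := n) s).HasTemperateGrowth := by
  have h1 := Function.hasTemperateGrowth_one_add_norm_sq_rpow (EuclideanSpace ℝ (Fin n)) (s / 2)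
  have h2 : Function.HasTemperateGrowth
      (fun ξ : EuclideanSpace ℝ (Fin n) => ((2 * Real.pi) • ξ)) := by fun_prop
  have h3 := h1.comp h2
  have h4 : (besselSymbol (n := n) s) = fun ξ => Complex.ofReal
      (((fun x : EuclideanSpace ℝ (Fin n) => (1 + ‖x‖ ^ 2) ^ (s / 2)) ∘
        (fun ξ : EuclideanSpace ℝ (Fin n) => ((2 * Real.pi) • ξ))) ξ) := by
    funext ξ
    simp only [besselSymbol, Function.comp_apply, norm_smul, Real.norm_eq_abs, mul_pow, sq_abs]
    norm_num
  rw [h4]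
  fun_prop

/-- The operator `(I - Δ)^{s/2}` on Schwartz functions. -/
noncomputable def besselOp {n : ℕ} (s : ℝ) :
    𝓢(EuclideanSpace ℝ (Fin n), ℂ) →L[ℂ] 𝓢(EuclideanSpace ℝ (Fin n), ℂ) :=
  SchwartzMap.fourierMultiplierCLM ℂ (besselSymbol s)

/-- `(I - Δ)^{s/2} h = g` in the sense of tempered distributions. As the symbol is even, the
operator is its own transpose. -/
def IsBesselImage {n : ℕ} (s : ℝ) (h g : EuclideanSpace ℝ (Fin n) → ℂ) : Prop :=
  ∀ φ : 𝓢(EuclideanSpace ℝ (Fin n), ℂ), ∫ x, h x * besselOp s φ x = ∫ x, g x * φ x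

/-- The Sobolev norm `‖h‖_{L^r_s} = ‖(I - Δ)^{s/2} h‖_{L^r}` (for `s ≥ 0`), with values in
`[0, ∞]`; it is `∞` if `h` is not in the Sobolev space. The function `g` is unique up to null sets,
if it exists. -/
noncomputable def sobolevNorm {n : ℕ} (r s : ℝ) (h : EuclideanSpace ℝ (Fin n) → ℂ) : ℝ≥0∞ :=
  ⨅ (g : EuclideanSpace ℝ (Fin n) → ℂ)
    (_ : MemLp h (ENNReal.ofReal r) volume ∧ MemLp g (ENNReal.ofReal r) volume ∧
      IsBesselImage s h g),
    eLpNorm g (ENNReal.ofReal r) volume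

/-- `T_σ f (x) = ∫ f̂(ξ) σ(ξ) e^{2πi x·ξ} dξ` for a Schwartz function `f`. -/
noncomputable def multiplierOp {n : ℕ} (σ : EuclideanSpace ℝ (Fin n) → ℂ)
    (f : 𝓢(EuclideanSpace ℝ (Fin n), ℂ)) (x : EuclideanSpace ℝ (Fin n)) : ℂ :=
  ∫ ξ, (𝓕 f) ξ * σ ξ * Complex.exp (2 * Real.pi * Complex.I * (inner ℝ x ξ : ℝ))

/-- The norm `‖T_σ‖_{L^p → L^p}`: the least constant in `‖T_σ f‖_{L^p} ≤ c ‖f‖_{L^p}` over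
all Schwartz functions `f`, and `∞` if `T_σ` is not bounded. -/
noncomputable def multiplierNorm {n : ℕ} (p : ℝ) (σ : EuclideanSpace ℝ (Fin n) → ℂ) : ℝ≥0∞ :=
  sInf {c : ℝ≥0∞ | ∀ f : 𝓢(EuclideanSpace ℝ (Fin n), ℂ),
    eLpNorm (multiplierOp σ f) (ENNReal.ofReal p) volume
      ≤ c * eLpNorm f (ENNReal.ofReal p) volume}

/-- `Ψ` is a Schwartz function whose Fourier transform lives in the annulus `1/2 < |ξ| < 2` and
satisfies `∑_{j ∈ ℤ} Ψ̂(2^{-j} ξ) = 1` for `ξ ≠ 0`. -/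
def IsDyadicPartition {n : ℕ} (Ψ : 𝓢(EuclideanSpace ℝ (Fin n), ℂ)) : Prop :=
  (∀ ξ : EuclideanSpace ℝ (Fin n), (𝓕 Ψ) ξ ≠ 0 → 1 / 2 < ‖ξ‖ ∧ ‖ξ‖ < 2) ∧
  ∀ ξ : EuclideanSpace ℝ (Fin n), ξ ≠ 0 →
    HasSum (fun j : ℤ => (𝓕 Ψ) ((2 : ℝ) ^ (-j) • ξ)) 1

/-- `sup_{k ∈ ℤ} ‖σ(2^k ·) Ψ̂‖_{L^r_s}`. -/
noncomputable def hormanderNorm {n : ℕ} (Ψ : 𝓢(EuclideanSpace ℝ (Fin n), ℂ)) (r s : ℝ)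
    (σ : EuclideanSpace ℝ (Fin n) → ℂ) : ℝ≥0∞ :=
  ⨆ k : ℤ, sobolevNorm r s (fun ξ => σ ((2 : ℝ) ^ k • ξ) * (𝓕 Ψ) ξ)

/-! ### Gaussian integrals against a Fourier transform -/

section Gaussian

variable {V : Type*} [NormedAddCommGroup V] [InnerProductSpace ℝ V]

/-! The hypothesis is tested on two families `σ_N = e_N Ψ̂`, `N → ∞`, localized to the annulus, so
that only three dyadic scales contribute to the right-hand side.

Bumps, `e_N(ξ) = φ(N(ξ - ξ₀))` with `|ξ₀| = 1` and `φ(0) = 1`: each derivative costs a factor `N`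
and the mass is of order `N^{-n}`, so the Sobolev norm is at most a constant times `N^{s - n/r}`. An
`L^p` multiplier norm dominates the values of the symbol, here `σ_N(ξ₀) = 1`. Hence `s - n/r ≥ 0`
(`IsDyadicPartition.natCast_le_mul`).

Chirps, `e_N(ξ) = exp(iN|ξ|²)`: the Sobolev norm is at most a constant times `N^s`. By the
dispersive estimate the kernel is of size `N^{-n/2}`, while Plancherel fixes its `L²` norm;
interpolating between the two forces the multiplier norm to be at least of order `N^{n|1/p - 1/2|}`
(`mul_abs_le_of_chirp_multiplier_bound`, `IsDyadicPartition.mul_abs_le`).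

The technical point is the upper bound on Sobolev norms for fractional `s`. The operator `(I -
Δ)^{s/2}` is a superposition of powers of `1 - R_t`, with `R_t = (I + t(I - Δ))⁻¹` a contraction on
`L¹` and `L^∞` because its kernel is a positive mixture of Gaussians. This bounds `(I - Δ)^{s/2} h`
at the endpoints by `h` and `(I - Δ)^M h` (`exists_eLpNorm_besselOp_le`); the latter only involves
ordinary derivatives. The bound in `L^r` follows by Hölder (`IsOscillatory.exists_sobolevNorm_le`).
-/

/-- The Gaussian of total mass one whose Fourier transform is `exp (-b ‖ξ‖ ^ 2)`. -/
noncomputable def gaussianKernel (b : ℝ) (z : V) : ℝ :=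
  (Real.pi / b) ^ (Module.finrank ℝ V / 2 : ℝ) * Real.exp (-(Real.pi ^ 2 / b) * ‖z‖ ^ 2)

theorem gaussianKernel_nonneg {b : ℝ} (hb : 0 < b) (z : V) : 0 ≤ gaussianKernel b z := by
  unfold gaussianKernel; positivity

variable [MeasurableSpace V] [BorelSpace V]

theorem measurable_gaussianKernel_uncurry :
    Measurable fun q : ℝ × V => gaussianKernel q.1 q.2 := by
  unfold gaussianKernel
  fun_prop

variable [FiniteDimensional ℝ V]

theorem SchwartzMap.fourierInv_apply_eq_integral (g : 𝓢(V, ℂ)) (x : V) :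
    (𝓕⁻ g) x = ∫ ξ, g ξ * Complex.exp (2 * Real.pi * Complex.I * (inner ℝ x ξ : ℝ)) := by
  rw [SchwartzMap.fourierInv_coe, Real.fourierInv_eq']
  refine integral_congr_ae (.of_forall fun ξ => ?_)
  simp only [smul_eq_mul, real_inner_comm]
  rw [mul_comm]
  congr 2
  push_cast
  rw [real_inner_comm]
  ring

/-- The multiplication formula moves the transform from `h` to a modulated Gaussian. The parameter
is complex to serve two purposes: real `b` gives the heat kernels behind the resolvent, and `b` near
the imaginary axis gives the chirps. -/
theorem integral_gaussian_mul_fourier {b : ℂ} (hb : 0 < b.re) (h : 𝓢(V, ℂ)) (x : V) :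
    ∫ ξ, Complex.exp (-b * ‖ξ‖ ^ 2) * (𝓕 h) ξ
        * Complex.exp (2 * Real.pi * Complex.I * (inner ℝ x ξ : ℝ))
      = ∫ y, (Real.pi / b) ^ (Module.finrank ℝ V / 2 : ℂ)
          * Complex.exp (-Real.pi ^ 2 * ‖x - y‖ ^ 2 / b) * h y := by
  have hint := GaussianFourier.integrable_cexp_neg_mul_sq_norm_add hb (2 * Real.pi * Complex.I) x
  have key := VectorFourier.integral_bilin_fourierIntegral_eq_flip
    (ContinuousLinearMap.mul ℂ ℂ) (L := innerₗ V) Real.continuous_fourierChar continuous_inner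
    h.integrable hint (μ := volume) (ν := volume)
  have e1 : ∀ ξ : V, Complex.exp (-b * ‖ξ‖ ^ 2) * (𝓕 h) ξ
        * Complex.exp (2 * Real.pi * Complex.I * (inner ℝ x ξ : ℝ)) =
      (ContinuousLinearMap.mul ℂ ℂ
        (VectorFourier.fourierIntegral Real.fourierChar volume (innerₗ V) h ξ))
        (Complex.exp (-b * ‖ξ‖ ^ 2 + 2 * Real.pi * Complex.I * (inner ℝ x ξ : ℝ))) := by
    intro ξ
    rw [Complex.exp_add, ContinuousLinearMap.mul_apply']
    change _ = (𝓕 h) ξ * _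
    ring
  simp_rw [e1]
  rw [key]
  refine integral_congr_ae (.of_forall fun y => ?_)
  simp only [ContinuousLinearMap.mul_apply', flip_innerₗ]
  have := fourier_gaussian_innerProductSpace' hb x y
  rw [Real.fourier_eq] at this
  change h y * (∫ v, _) = _
  rw [mul_comm]
  congr 1

/-- Dispersive estimate: since `Re (1/b) ≥ 0`, the kernel is bounded by its prefactor. The bound
depends on `b` only through `‖b‖`, so it survives the limit `Re b → 0`. -/
theorem norm_integral_gaussian_mul_fourier_le {b : ℂ} (hb : 0 < b.re) (h : 𝓢(V, ℂ)) (x : V) :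
    ‖∫ ξ, Complex.exp (-b * ‖ξ‖ ^ 2) * (𝓕 h) ξ
        * Complex.exp (2 * Real.pi * Complex.I * (inner ℝ x ξ : ℝ))‖
      ≤ (Real.pi / ‖b‖) ^ (Module.finrank ℝ V / 2 : ℝ) * ∫ y, ‖h y‖ := by
  have hb0 : b ≠ 0 := by rintro rfl; simp at hb
  rw [integral_gaussian_mul_fourier hb, ← integral_const_mul]
  refine norm_integral_le_of_norm_le (h.integrable.norm.const_mul _) (.of_forall fun y => ?_)
  rw [norm_mul, norm_mul]
  refine mul_le_mul_of_nonneg_right ?_ (norm_nonneg _)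
  have h1 : ‖((Real.pi : ℂ) / b) ^ (Module.finrank ℝ V / 2 : ℂ)‖
      = (Real.pi / ‖b‖) ^ (Module.finrank ℝ V / 2 : ℝ) := by
    have : (Module.finrank ℝ V / 2 : ℂ) = ((Module.finrank ℝ V / 2 : ℝ) : ℂ) := by push_cast; rfl
    rw [this, Complex.norm_cpow_real]
    simp [abs_of_pos Real.pi_pos]
  have h2 : ‖Complex.exp (-Real.pi ^ 2 * ‖x - y‖ ^ 2 / b)‖ ≤ 1 := by
    rw [Complex.norm_exp, Real.exp_le_one_iff]
    have : (-(Real.pi : ℂ) ^ 2 * (‖x - y‖ : ℂ) ^ 2 / b)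
        = ((-Real.pi ^ 2 * ‖x - y‖ ^ 2 : ℝ) : ℂ) * b⁻¹ := by
      push_cast; rw [div_eq_mul_inv]
    rw [this, Complex.re_ofReal_mul, Complex.inv_re]
    have : 0 ≤ b.re / Complex.normSq b := div_nonneg hb.le (Complex.normSq_nonneg _)
    have h3 : 0 ≤ Real.pi ^ 2 * ‖x - y‖ ^ 2 := by positivity
    nlinarith
  rw [h1]
  exact mul_le_of_le_one_right (by positivity) h2

theorem lintegral_gaussianKernel {b : ℝ} (hb : 0 < b) :
    ∫⁻ z : V, ENNReal.ofReal (gaussianKernel b z) = 1 := by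
  have hc : 0 < Real.pi ^ 2 / b := by positivity
  have hint : Integrable fun z : V => Real.exp (-(Real.pi ^ 2 / b) * ‖z‖ ^ 2) := by
    have := (GaussianFourier.integrable_cexp_neg_mul_sq_norm_add (V := V)
      (b := ((Real.pi ^ 2 / b : ℝ) : ℂ)) (by rwa [Complex.ofReal_re]) 0 0).norm
    refine this.congr (.of_forall fun z => ?_)
    simp only [zero_mul, add_zero, Complex.norm_exp]
    congr 1
    rw [← Complex.ofReal_neg, ← Complex.ofReal_pow, ← Complex.ofReal_mul, Complex.ofReal_re]
  have hint' : Integrable fun z : V => gaussianKernel b z := hint.const_mul _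
  rw [← ofReal_integral_eq_lintegral_ofReal hint'
    (.of_forall fun z => gaussianKernel_nonneg hb z)]
  unfold gaussianKernel
  rw [integral_const_mul, GaussianFourier.integral_rexp_neg_mul_sq_norm hc,
    ← Real.mul_rpow (by positivity) (by positivity)]
  have : Real.pi / b * (Real.pi / (Real.pi ^ 2 / b)) = 1 := by field_simp
  rw [this, Real.one_rpow, ENNReal.ofReal_one]

theorem enorm_integral_gaussian_mul_fourier_le {b : ℝ} (hb : 0 < b) (h : 𝓢(V, ℂ)) (x : V) :
    ‖∫ ξ, Complex.exp (-b * ‖ξ‖ ^ 2) * (𝓕 h) ξ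
        * Complex.exp (2 * Real.pi * Complex.I * (inner ℝ x ξ : ℝ))‖ₑ
      ≤ ∫⁻ y, ENNReal.ofReal (gaussianKernel b (x - y)) * ‖h y‖ₑ := by
  rw [integral_gaussian_mul_fourier (by simpa using hb)]
  refine (enorm_integral_le_lintegral_enorm _).trans (le_of_eq ?_)
  refine lintegral_congr fun y => ?_
  rw [enorm_mul]
  congr 1
  have : ((Real.pi : ℂ) / b) ^ (Module.finrank ℝ V / 2 : ℂ)
      * Complex.exp (-Real.pi ^ 2 * ‖x - y‖ ^ 2 / b)
      = ((gaussianKernel b (x - y) : ℝ) : ℂ) := by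
    unfold gaussianKernel
    push_cast
    rw [Complex.ofReal_cpow (by positivity)]
    push_cast
    congr 2
    ring
  rw [this, ← ofReal_norm, Complex.norm_real, Real.norm_eq_abs,
    abs_of_nonneg (gaussianKernel_nonneg hb _)]

end Gaussian

/-! ### Contractivity of the resolvent on `L¹` and `L^∞` -/

section Resolvent

variable {n : ℕ}

local notation "𝔼" => EuclideanSpace ℝ (Fin n)

theorem fourierMultiplierCLM_apply_eq_integral {g : 𝔼 → ℂ} (hg : g.HasTemperateGrowth)
    (h : 𝓢(𝔼, ℂ)) (x : 𝔼) :
    SchwartzMap.fourierMultiplierCLM ℂ g h x =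
      ∫ ξ, g ξ * (𝓕 h) ξ * Complex.exp (2 * Real.pi * Complex.I * (inner ℝ x ξ : ℝ)) := by
  rw [SchwartzMap.fourierMultiplierCLM_apply, SchwartzMap.fourierInv_apply_eq_integral]
  simp_rw [SchwartzMap.smulLeftCLM_apply_apply hg, smul_eq_mul]

/-- The symbol `1 + 4π²|ξ|²` of `I - Δ`. -/
noncomputable def laplaceSymbol (ξ : 𝔼) : ℝ := 1 + 4 * Real.pi ^ 2 * ‖ξ‖ ^ 2

theorem one_le_laplaceSymbol (ξ : 𝔼) : 1 ≤ laplaceSymbol ξ := by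
  unfold laplaceSymbol
  have : 0 ≤ 4 * Real.pi ^ 2 * ‖ξ‖ ^ 2 := by positivity
  linarith

theorem continuous_laplaceSymbol : Continuous (laplaceSymbol (n := n)) := by
  unfold laplaceSymbol; fun_prop

/-- The symbol of the resolvent `(I + t (I - Δ))⁻¹`. -/
noncomputable def resolventSymbol (t : ℝ) (ξ : 𝔼) : ℂ := (((1 + t * laplaceSymbol ξ)⁻¹ : ℝ) : ℂ)

theorem resolventSymbol_hasTemperateGrowth {t : ℝ} (ht : 0 ≤ t) :
    (resolventSymbol (n := n) t).HasTemperateGrowth := by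
  have h1 := Function.hasTemperateGrowth_one_add_norm_sq_rpow 𝔼 (-1)
  -- The scaling comes from `1 + t(1 + 4π²|ξ|²) = (1 + t)(1 + 4π² (t/(1+t)) |ξ|²)`.
  have h2 : Function.HasTemperateGrowth
      (fun ξ : 𝔼 => ((2 * Real.pi * Real.sqrt (t / (1 + t))) • ξ)) := by fun_prop
  have h3 := h1.comp h2
  have h4 : resolventSymbol (n := n) t = fun ξ => Complex.ofReal ((1 + t)⁻¹ *
      (((fun x : 𝔼 => (1 + ‖x‖ ^ 2) ^ (-1 : ℝ)) ∘
        (fun ξ : 𝔼 => ((2 * Real.pi * Real.sqrt (t / (1 + t))) • ξ))) ξ)) := by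
    funext ξ
    simp only [resolventSymbol, laplaceSymbol, Function.comp_apply, norm_smul, Real.norm_eq_abs,
      mul_pow, sq_abs, Real.rpow_neg_one]
    rw [Real.sq_sqrt (by positivity), ← mul_inv]
    congr 2
    field_simp
    ring
  rw [h4]
  fun_prop

/-- The resolvent `(I + t (I - Δ))⁻¹` on Schwartz functions. -/
noncomputable def resolventOp (t : ℝ) : 𝓢(𝔼, ℂ) →L[ℂ] 𝓢(𝔼, ℂ) :=
  SchwartzMap.fourierMultiplierCLM ℂ (resolventSymbol t)

/-- Subordination: `1/(1 + tw) = ∫₀^∞ e^{-(1+tw)u} du` with `w = 1 + 4π²|ξ|²`, followed by Fubini.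
For each `u` the symbol left over is a Gaussian in `ξ`. -/
theorem resolventOp_apply_eq_integral {t : ℝ} (ht : 0 < t) (h : 𝓢(𝔼, ℂ)) (x : 𝔼) :
    resolventOp t h x = ∫ u in Set.Ioi (0 : ℝ), (Real.exp (-(1 + t) * u) : ℂ) *
      ∫ ξ, Complex.exp (-((4 * Real.pi ^ 2 * (t * u) : ℝ) : ℂ) * ‖ξ‖ ^ 2) * (𝓕 h) ξ *
        Complex.exp (2 * Real.pi * Complex.I * (inner ℝ x ξ : ℝ)) := by
  rw [resolventOp, fourierMultiplierCLM_apply_eq_integral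
    (resolventSymbol_hasTemperateGrowth ht.le)]
  let F : 𝔼 → ℝ → ℂ := fun ξ u => (Real.exp (-(1 + t * laplaceSymbol ξ) * u) : ℂ) * ((𝓕 h) ξ *
    Complex.exp (2 * Real.pi * Complex.I * (inner ℝ x ξ : ℝ)))
  have hnorm : ∀ ξ : 𝔼, ‖Complex.exp (2 * Real.pi * Complex.I * (inner ℝ x ξ : ℝ))‖ = 1 := by
    intro ξ
    rw [show 2 * Real.pi * Complex.I * ((inner ℝ x ξ : ℝ) : ℂ)
      = ((2 * Real.pi * inner ℝ x ξ : ℝ) : ℂ) * Complex.I by push_cast; ring,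
      Complex.norm_exp_ofReal_mul_I]
  have hF : Integrable (Function.uncurry F)
      ((volume : Measure 𝔼).prod (volume.restrict (Set.Ioi (0 : ℝ)))) := by
    have hdom : Integrable (fun q : 𝔼 × ℝ => ‖(𝓕 h) q.1‖ * Real.exp (-q.2))
        ((volume : Measure 𝔼).prod (volume.restrict (Set.Ioi (0 : ℝ)))) :=
      (𝓕 h).integrable.norm.mul_prod (integrableOn_exp_neg_Ioi 0)
    refine hdom.mono' ?_ ?_
    · have := continuous_laplaceSymbol (n := n)
      have := (𝓕 h).continuous
      refine Continuous.aestronglyMeasurable ?_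
      simp only [F, Function.uncurry_def]
      fun_prop
    · have : ∀ᵐ q : 𝔼 × ℝ ∂((volume : Measure 𝔼).prod (volume.restrict (Set.Ioi (0 : ℝ)))),
          0 < q.2 := by
        rw [← Measure.restrict_univ (μ := (volume : Measure 𝔼)), Measure.prod_restrict]
        filter_upwards [ae_restrict_mem (MeasurableSet.univ.prod measurableSet_Ioi)] with q hq
        exact hq.2
      filter_upwards [this] with q hq
      simp only [F, Function.uncurry_def, norm_mul, hnorm, mul_one, Complex.norm_real]
      rw [Real.norm_eq_abs, abs_of_pos (Real.exp_pos _), mul_comm]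
      refine mul_le_mul_of_nonneg_left (Real.exp_le_exp.2 ?_) (norm_nonneg _)
      have := one_le_laplaceSymbol q.1
      have : 0 ≤ t * laplaceSymbol q.1 * q.2 := by positivity
      nlinarith
  have h1 : ∀ ξ : 𝔼, resolventSymbol t ξ * (𝓕 h) ξ *
      Complex.exp (2 * Real.pi * Complex.I * (inner ℝ x ξ : ℝ))
      = ∫ u in Set.Ioi (0 : ℝ), F ξ u := by
    intro ξ
    have hw := one_le_laplaceSymbol ξ
    have hpos : 0 < 1 + t * laplaceSymbol ξ := by positivity
    simp only [F]
    rw [integral_mul_const, integral_complex_ofReal, integral_exp_mul_Ioi (by linarith)]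
    rw [resolventSymbol, mul_assoc]
    congr 2
    rw [mul_zero, Real.exp_zero, neg_div_neg_eq, one_div]
  simp_rw [h1]
  rw [integral_integral_swap hF]
  refine integral_congr_ae (.of_forall fun u => ?_)
  simp only [F]
  rw [← integral_const_mul]
  refine integral_congr_ae (.of_forall fun ξ => ?_)
  have : (Real.exp (-(1 + t * laplaceSymbol ξ) * u) : ℂ) = (Real.exp (-(1 + t) * u) : ℂ) *
      Complex.exp (-((4 * Real.pi ^ 2 * (t * u) : ℝ) : ℂ) * ‖ξ‖ ^ 2) := by
    unfold laplaceSymbol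
    rw [Complex.ofReal_exp, Complex.ofReal_exp, ← Complex.exp_add]
    congr 1
    push_cast
    ring
  simp only [this]
  ring

/-- Discarding `e^{-tu} ≤ 1` leaves an average, with probability weight `e^{-u} du`, of convolutions
with Gaussians of mass one. Both endpoint contractions follow from this. -/
theorem enorm_resolventOp_apply_le {t : ℝ} (ht : 0 < t) (h : 𝓢(𝔼, ℂ)) (x : 𝔼) :
    ‖resolventOp t h x‖ₑ ≤ ∫⁻ u in Set.Ioi (0 : ℝ), ENNReal.ofReal (Real.exp (-u)) *
      ∫⁻ y, ENNReal.ofReal (gaussianKernel (4 * Real.pi ^ 2 * (t * u)) (x - y)) * ‖h y‖ₑ := by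
  rw [resolventOp_apply_eq_integral ht]
  refine (enorm_integral_le_lintegral_enorm _).trans ?_
  refine setLIntegral_mono_ae' measurableSet_Ioi (.of_forall fun u (hu : 0 < u) => ?_)
  rw [enorm_mul]
  refine mul_le_mul' ?_ (enorm_integral_gaussian_mul_fourier_le (by positivity) h x)
  rw [← ofReal_norm, Complex.norm_real, Real.norm_eq_abs, abs_of_pos (Real.exp_pos _)]
  refine ENNReal.ofReal_le_ofReal (Real.exp_le_exp.2 ?_)
  nlinarith [mul_pos ht hu]

theorem lintegral_exp_neg_Ioi : ∫⁻ u in Set.Ioi (0 : ℝ), ENNReal.ofReal (Real.exp (-u)) = 1 := by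
  rw [← ofReal_integral_eq_lintegral_ofReal (integrableOn_exp_neg_Ioi 0)
    (.of_forall fun u => (Real.exp_pos _).le), integral_exp_neg_Ioi]
  simp

theorem eLpNorm_top_resolventOp_le {t : ℝ} (ht : 0 < t) (h : 𝓢(𝔼, ℂ)) :
    eLpNorm (resolventOp t h) ∞ volume ≤ eLpNorm h ∞ volume := by
  rw [eLpNorm_exponent_top]
  refine essSup_le_of_ae_le _ (.of_forall fun x => ?_)
  refine (enorm_resolventOp_apply_le ht h x).trans ?_
  calc _ ≤ ∫⁻ u in Set.Ioi (0 : ℝ), ENNReal.ofReal (Real.exp (-u)) * eLpNorm h ∞ volume := by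
        refine setLIntegral_mono_ae' measurableSet_Ioi (.of_forall fun u (hu : 0 < u) => ?_)
        refine mul_le_mul' le_rfl ?_
        calc _ ≤ ∫⁻ y, ENNReal.ofReal (gaussianKernel (4 * Real.pi ^ 2 * (t * u)) (x - y))
                * eLpNorm h ∞ volume := by
              refine lintegral_mono_ae ?_
              filter_upwards [enorm_ae_le_eLpNormEssSup h volume] with y hy
              rw [eLpNorm_exponent_top]
              exact mul_le_mul' le_rfl hy
          _ = _ := by
              have hm : Measurable fun z : 𝔼 =>
                  ENNReal.ofReal (gaussianKernel (4 * Real.pi ^ 2 * (t * u)) z) :=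
                (measurable_gaussianKernel_uncurry.comp (measurable_const.prodMk
                  measurable_id)).ennreal_ofReal
              have hm' : Measurable fun y : 𝔼 => ENNReal.ofReal
                  (gaussianKernel (4 * Real.pi ^ 2 * (t * u)) (x - y)) :=
                hm.comp (measurable_const.sub measurable_id)
              rw [lintegral_mul_const _ hm',
                lintegral_sub_left_eq_self
                  (fun z : 𝔼 => ENNReal.ofReal (gaussianKernel (4 * Real.pi ^ 2 * (t * u)) z)) x,
                lintegral_gaussianKernel (by positivity), one_mul]
    _ = _ := by
        rw [lintegral_mul_const _ (by fun_prop), lintegral_exp_neg_Ioi, one_mul]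

theorem eLpNorm_one_resolventOp_le {t : ℝ} (ht : 0 < t) (h : 𝓢(𝔼, ℂ)) :
    eLpNorm (resolventOp t h) 1 volume ≤ eLpNorm h 1 volume := by
  rw [eLpNorm_one_eq_lintegral_enorm, eLpNorm_one_eq_lintegral_enorm]
  refine (lintegral_mono fun x => enorm_resolventOp_apply_le ht h x).trans ?_
  have hh : Measurable fun y : 𝔼 => ‖h y‖ₑ := h.continuous.measurable.enorm
  have hm3 : Measurable fun q : (𝔼 × ℝ) × 𝔼 => ENNReal.ofReal
      (gaussianKernel (4 * Real.pi ^ 2 * (t * q.1.2)) (q.1.1 - q.2)) * ‖h q.2‖ₑ := by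
    refine Measurable.mul ?_ (hh.comp measurable_snd)
    refine (measurable_gaussianKernel_uncurry.comp (Measurable.prodMk (f := fun q : (𝔼 × ℝ) × 𝔼 =>
      4 * Real.pi ^ 2 * (t * q.1.2)) (g := fun q => q.1.1 - q.2) ?_ ?_)).ennreal_ofReal <;> fun_prop
  rw [lintegral_lintegral_swap]
  · calc _ = ∫⁻ u in Set.Ioi (0 : ℝ), ENNReal.ofReal (Real.exp (-u)) * ∫⁻ y, ‖h y‖ₑ := by
          refine setLIntegral_congr_fun measurableSet_Ioi fun u (hu : 0 < u) => ?_
          have hm2 : Measurable fun q : 𝔼 × 𝔼 => ENNReal.ofReal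
              (gaussianKernel (4 * Real.pi ^ 2 * (t * u)) (q.1 - q.2)) * ‖h q.2‖ₑ :=
            hm3.comp (f := fun q : 𝔼 × 𝔼 => (((q.1, u), q.2) : (𝔼 × ℝ) × 𝔼)) (by fun_prop)
          have hm : Measurable fun z : 𝔼 =>
              ENNReal.ofReal (gaussianKernel (4 * Real.pi ^ 2 * (t * u)) z) :=
            (measurable_gaussianKernel_uncurry.comp (measurable_const.prodMk
              measurable_id)).ennreal_ofReal
          rw [lintegral_const_mul _ hm2.lintegral_prod_right', lintegral_lintegral_swap
            hm2.aemeasurable]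
          congr 1
          refine lintegral_congr fun y => ?_
          have hm' : Measurable fun z : 𝔼 => ENNReal.ofReal
              (gaussianKernel (4 * Real.pi ^ 2 * (t * u)) (z - y)) :=
            hm.comp (measurable_id.sub measurable_const)
          dsimp only
          rw [lintegral_mul_const _ hm',
            lintegral_sub_right_eq_self
              (fun z : 𝔼 => ENNReal.ofReal (gaussianKernel (4 * Real.pi ^ 2 * (t * u)) z)) y,
            lintegral_gaussianKernel (by positivity), one_mul]
      _ = _ := by
          rw [lintegral_mul_const _ (by fun_prop), lintegral_exp_neg_Ioi, one_mul]
      _ ≤ _ := le_rfl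
  · refine Measurable.aemeasurable ?_
    have := hm3.lintegral_prod_right' (ν := (volume : Measure 𝔼))
    simp only [Function.uncurry_def]
    exact Measurable.mul (by fun_prop) this

end Resolvent

/-! ### Algebra of the resolvents and the Mellin profile of a power -/

section Interpolation

variable {n : ℕ}

local notation "𝔼" => EuclideanSpace ℝ (Fin n)

theorem fourier_fourierMultiplierCLM_apply {g : 𝔼 → ℂ} (hg : g.HasTemperateGrowth)
    (h : 𝓢(𝔼, ℂ)) (ξ : 𝔼) :
    (𝓕 (SchwartzMap.fourierMultiplierCLM ℂ g h)) ξ = g ξ * (𝓕 h) ξ := by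
  rw [SchwartzMap.fourierMultiplierCLM_apply, FourierTransform.fourier_fourierInv_eq,
    SchwartzMap.smulLeftCLM_apply_apply hg, smul_eq_mul]

theorem SchwartzMap.ext_fourier {f g : 𝓢(𝔼, ℂ)} (h : ∀ ξ, (𝓕 f) ξ = (𝓕 g) ξ) : f = g := by
  have : 𝓕 f = 𝓕 g := SchwartzMap.ext h
  have h2 := congrArg (fun k : 𝓢(𝔼, ℂ) => 𝓕⁻ k) this
  simpa using h2

theorem SchwartzMap.fourier_sub_apply (f g : 𝓢(𝔼, ℂ)) (ξ : 𝔼) :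
    (𝓕 (f - g)) ξ = (𝓕 f) ξ - (𝓕 g) ξ := by
  have : 𝓕 (f - g) = 𝓕 f - 𝓕 g := map_sub (FourierTransform.fourierCLM ℂ 𝓢(𝔼, ℂ)) f g
  rw [this]; rfl

theorem SchwartzMap.fourier_smul_apply (c : ℂ) (f : 𝓢(𝔼, ℂ)) (ξ : 𝔼) :
    (𝓕 (c • f)) ξ = c * (𝓕 f) ξ := by
  have : 𝓕 (c • f) = c • 𝓕 f := map_smul (FourierTransform.fourierCLM ℂ 𝓢(𝔼, ℂ)) c f
  rw [this]; rfl

theorem fourier_besselOp_apply (s : ℝ) (h : 𝓢(𝔼, ℂ)) (ξ : 𝔼) :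
    (𝓕 (besselOp s h)) ξ = ((laplaceSymbol ξ ^ (s / 2) : ℝ) : ℂ) * (𝓕 h) ξ :=
  fourier_fourierMultiplierCLM_apply (besselSymbol_hasTemperateGrowth s) h ξ

theorem fourier_besselOp_two_apply (h : 𝓢(𝔼, ℂ)) (ξ : 𝔼) :
    (𝓕 (besselOp 2 h)) ξ = (laplaceSymbol ξ : ℂ) * (𝓕 h) ξ := by
  rw [fourier_besselOp_apply, div_self two_ne_zero, Real.rpow_one]

theorem fourier_resolventOp_apply {t : ℝ} (ht : 0 ≤ t) (h : 𝓢(𝔼, ℂ)) (ξ : 𝔼) :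
    (𝓕 (resolventOp t h)) ξ = (((1 + t * laplaceSymbol ξ)⁻¹ : ℝ) : ℂ) * (𝓕 h) ξ :=
  fourier_fourierMultiplierCLM_apply (resolventSymbol_hasTemperateGrowth ht) h ξ

theorem commute_resolventOp_besselOp {t : ℝ} (ht : 0 ≤ t) (s : ℝ) :
    Commute (resolventOp (n := n) t) (besselOp s) := by
  refine ContinuousLinearMap.ext fun h => SchwartzMap.ext_fourier fun ξ => ?_
  simp only [mul_apply_eq_comp, fourier_resolventOp_apply ht, fourier_besselOp_apply]
  ring

/-- On the Fourier side this is `1 - 1/(1+tw) = tw/(1+tw)`. It makes `1 - R_t` small for small `t`,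
at the price of one `I - Δ`; for large `t` the contraction bound `2` is the better one. -/
theorem one_sub_resolventOp {t : ℝ} (ht : 0 ≤ t) :
    1 - resolventOp (n := n) t = (t : ℂ) • (resolventOp t * besselOp 2) := by
  refine ContinuousLinearMap.ext fun h => SchwartzMap.ext_fourier fun ξ => ?_
  simp only [mul_apply_eq_comp, sub_apply, smul_apply, one_apply_eq_self,
    SchwartzMap.fourier_sub_apply, SchwartzMap.fourier_smul_apply, fourier_resolventOp_apply ht,
    fourier_besselOp_two_apply]
  have := one_le_laplaceSymbol ξ
  have h1 : ((1 + t * laplaceSymbol ξ : ℝ) : ℂ) ≠ 0 := by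
    exact_mod_cast (by positivity : (1 + t * laplaceSymbol ξ : ℝ) ≠ 0)
  push_cast at h1 ⊢
  field_simp
  ring

theorem one_sub_resolventOp_pow {t : ℝ} (ht : 0 ≤ t) (M : ℕ) :
    (1 - resolventOp (n := n) t) ^ M = (t : ℂ) ^ M • (resolventOp t ^ M * besselOp 2 ^ M) := by
  rw [one_sub_resolventOp ht, smul_pow, (commute_resolventOp_besselOp ht 2).mul_pow]

theorem fourier_one_sub_resolventOp_pow_apply {t : ℝ} (ht : 0 ≤ t) (M : ℕ) (h : 𝓢(𝔼, ℂ)) (ξ : 𝔼) :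
    (𝓕 (((1 - resolventOp (n := n) t) ^ M) h)) ξ =
      (((t * laplaceSymbol ξ / (1 + t * laplaceSymbol ξ)) ^ M : ℝ) : ℂ) * (𝓕 h) ξ := by
  induction M generalizing h with
  | zero => simp
  | succ M ih =>
    rw [pow_succ, mul_apply_eq_comp, ih]
    simp only [sub_apply, one_apply_eq_self, SchwartzMap.fourier_sub_apply,
      fourier_resolventOp_apply ht]
    have := one_le_laplaceSymbol ξ
    have h1 : ((1 + t * laplaceSymbol ξ : ℝ) : ℂ) ≠ 0 := by
      exact_mod_cast (by positivity : (1 + t * laplaceSymbol ξ : ℝ) ≠ 0)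
    push_cast at h1 ⊢
    rw [pow_succ]
    field_simp
    ring

theorem eLpNorm_one_sub_resolventOp_pow_le {q : ℝ≥0∞} (hq : 1 ≤ q) {t : ℝ}
    (hR : ∀ h : 𝓢(𝔼, ℂ), eLpNorm (resolventOp t h) q volume ≤ eLpNorm h q volume)
    (M : ℕ) (h : 𝓢(𝔼, ℂ)) :
    eLpNorm (((1 - resolventOp t) ^ M) h) q volume ≤ 2 ^ M * eLpNorm h q volume := by
  induction M generalizing h with
  | zero => simp
  | succ M ih =>
    rw [pow_succ, mul_apply_eq_comp]
    refine (ih _).trans ?_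
    rw [pow_succ, mul_assoc]
    gcongr
    have : ⇑((1 - resolventOp t) h) = ⇑h - ⇑(resolventOp t h) := rfl
    rw [this]
    refine (eLpNorm_sub_le h.continuous.aestronglyMeasurable
      (resolventOp t h).continuous.aestronglyMeasurable hq).trans ?_
    rw [two_mul]
    gcongr
    exact hR h

theorem eLpNorm_one_sub_resolventOp_pow_le' {q : ℝ≥0∞} {t : ℝ} (ht : 0 ≤ t)
    (hR : ∀ h : 𝓢(𝔼, ℂ), eLpNorm (resolventOp t h) q volume ≤ eLpNorm h q volume)
    (M : ℕ) (h : 𝓢(𝔼, ℂ)) :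
    eLpNorm (((1 - resolventOp t) ^ M) h) q volume
      ≤ ENNReal.ofReal (t ^ M) * eLpNorm ((besselOp 2 ^ M) h) q volume := by
  rw [one_sub_resolventOp_pow ht]
  have : (((t : ℂ) ^ M • (resolventOp t ^ M * besselOp 2 ^ M) : 𝓢(𝔼, ℂ) →L[ℂ] 𝓢(𝔼, ℂ)) h : 𝔼 → ℂ)
      = (t : ℂ) ^ M • ((resolventOp t ^ M) ((besselOp 2 ^ M) h) : 𝔼 → ℂ) := rfl
  rw [this, eLpNorm_const_smul]
  have h2 : ∀ g : 𝓢(𝔼, ℂ), eLpNorm ((resolventOp t ^ M) g) q volume ≤ eLpNorm g q volume := by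
    intro g
    induction M generalizing g with
    | zero => simp
    | succ M ih =>
      rw [pow_succ, mul_apply_eq_comp]
      exact (ih rfl _).trans (hR g)
  refine mul_le_mul' (le_of_eq ?_) (h2 _)
  rw [← Complex.ofReal_pow, ← ofReal_norm, Complex.norm_real, Real.norm_eq_abs,
    abs_of_nonneg (by positivity)]

/-- The profile whose Mellin transform produces the powers of `I - Δ`. -/
noncomputable def resolventProfile (s : ℝ) (M : ℕ) (u : ℝ) : ℝ :=
  u ^ (-s / 2 - 1) * (u / (1 + u)) ^ M

theorem resolventProfile_nonneg (s : ℝ) (M : ℕ) {u : ℝ} (hu : 0 ≤ u) :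
    0 ≤ resolventProfile s M u := by
  unfold resolventProfile; positivity

/-- The profile is at most `u^{M - s/2 - 1}` near `0`, whence the condition `s < 2M`, and at most
`u^{-s/2 - 1}` at infinity, whence `s > 0`. -/
theorem integrableOn_resolventProfile {s : ℝ} (hs : 0 < s) {M : ℕ} (hM : s < 2 * M) :
    IntegrableOn (resolventProfile s M) (Set.Ioi 0) := by
  have hmeas : Measurable (resolventProfile s M) := by unfold resolventProfile; fun_prop
  rw [← Set.Ioc_union_Ioi_eq_Ioi (zero_le_one' ℝ)]
  refine IntegrableOn.union ?_ ?_
  · have h1 : IntegrableOn (fun u : ℝ => u ^ ((M : ℝ) - s / 2 - 1)) (Set.Ioc 0 1) := by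
      have := intervalIntegral.intervalIntegrable_rpow' (a := 0) (b := 1)
        (r := (M : ℝ) - s / 2 - 1) (by linarith)
      rwa [intervalIntegrable_iff_integrableOn_Ioc_of_le zero_le_one] at this
    refine h1.mono' hmeas.aestronglyMeasurable ?_
    refine (ae_restrict_iff' measurableSet_Ioc).2 (.of_forall fun u hu => ?_)
    rw [Real.norm_eq_abs, abs_of_nonneg (resolventProfile_nonneg s M hu.1.le)]
    unfold resolventProfile
    have : u ^ ((M : ℝ) - s / 2 - 1) = u ^ (-s / 2 - 1) * u ^ M := by
      rw [← Real.rpow_natCast u M, ← Real.rpow_add hu.1]; congr 1; ring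
    rw [this]
    have hu0 := hu.1.le
    gcongr
    exact div_le_self hu0 (by linarith)
  · have h1 : IntegrableOn (fun u : ℝ => u ^ (-s / 2 - 1)) (Set.Ioi 1) :=
      integrableOn_Ioi_rpow_of_lt (by linarith) one_pos
    refine h1.mono' hmeas.aestronglyMeasurable ?_
    refine (ae_restrict_iff' measurableSet_Ioi).2 (.of_forall fun u (hu : 1 < u) => ?_)
    have hu0 : 0 < u := by linarith
    rw [Real.norm_eq_abs, abs_of_nonneg (resolventProfile_nonneg s M hu0.le)]
    unfold resolventProfile
    refine mul_le_of_le_one_right (by positivity) (pow_le_one₀ (by positivity) ?_)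
    rw [div_le_one (by linarith)]
    linarith

theorem integral_resolventProfile_pos {s : ℝ} (hs : 0 < s) {M : ℕ} (hM : s < 2 * M) :
    0 < ∫ u in Set.Ioi (0 : ℝ), resolventProfile s M u := by
  rw [setIntegral_pos_iff_support_of_nonneg_ae]
  · have : Set.Ioi (0 : ℝ) ⊆ Function.support (resolventProfile s M) ∩ Set.Ioi 0 := by
      intro u (hu : 0 < u)
      refine ⟨?_, hu⟩
      rw [Function.mem_support]
      unfold resolventProfile
      positivity
    exact lt_of_lt_of_le (by simp) (measure_mono this)
  · exact (ae_restrict_iff' measurableSet_Ioi).2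
      (.of_forall fun u (hu : 0 < u) => resolventProfile_nonneg s M hu.le)
  · exact integrableOn_resolventProfile hs hM

theorem resolventProfile_mul (s : ℝ) (M : ℕ) {w t : ℝ} (hw : 0 < w) (ht : 0 < t) :
    t ^ (-s / 2 - 1) * (t * w / (1 + t * w)) ^ M
      = w ^ (s / 2 + 1) * resolventProfile s M (w * t) := by
  unfold resolventProfile
  rw [Real.mul_rpow hw.le ht.le, mul_comm t w]
  have : w ^ (s / 2 + 1) * w ^ (-s / 2 - 1) = 1 := by
    rw [← Real.rpow_add hw, ← Real.rpow_zero w]; congr 1; ring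
  linear_combination (-(t ^ (-s / 2 - 1) * (w * t / (1 + w * t)) ^ M)) * this

/-- The substitution `u = wt` turns the homogeneity of the integrand into the power `w^{s/2}`. -/
theorem integral_resolventProfile_mul (s : ℝ) (M : ℕ) {w : ℝ} (hw : 0 < w) :
    ∫ t in Set.Ioi (0 : ℝ), t ^ (-s / 2 - 1) * (t * w / (1 + t * w)) ^ M
      = w ^ (s / 2) * ∫ u in Set.Ioi (0 : ℝ), resolventProfile s M u := by
  rw [setIntegral_congr_fun measurableSet_Ioi fun t (ht : 0 < t) =>
    resolventProfile_mul s M hw ht, integral_const_mul,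
    integral_comp_mul_left_Ioi (resolventProfile s M) 0 hw, mul_zero, smul_eq_mul, ← mul_assoc,
    Real.rpow_add hw, Real.rpow_one, mul_assoc (w ^ (s / 2)), mul_inv_cancel₀ hw.ne', mul_one]

theorem integrableOn_resolventProfile_mul {s : ℝ} (hs : 0 < s) {M : ℕ} (hM : s < 2 * M) {w : ℝ}
    (hw : 0 < w) :
    IntegrableOn (fun t : ℝ => t ^ (-s / 2 - 1) * (t * w / (1 + t * w)) ^ M) (Set.Ioi 0) := by
  have hcongr : Set.EqOn (fun t : ℝ => t ^ (-s / 2 - 1) * (t * w / (1 + t * w)) ^ M)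
      (fun t => w ^ (s / 2 + 1) * resolventProfile s M (w * t)) (Set.Ioi 0) :=
    fun t ht => resolventProfile_mul s M hw ht
  rw [integrableOn_congr_fun hcongr measurableSet_Ioi]
  have h1 := integrableOn_resolventProfile hs hM
  rw [← mul_zero w, ← integrableOn_Ioi_comp_mul_left_iff _ _ hw] at h1
  exact h1.const_mul _

theorem integrableOn_resolventProfile_mul_complex {s : ℝ} (hs : 0 < s) {M : ℕ} (hM : s < 2 * M)
    {w : ℝ} (hw : 0 < w) (z : ℂ) :
    IntegrableOn (fun t : ℝ => ((t ^ (-s / 2 - 1) * (t * w / (1 + t * w)) ^ M : ℝ) : ℂ) * z)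
      (Set.Ioi 0) := by
  have h1 : IntegrableOn (fun t : ℝ => ((t ^ (-s / 2 - 1) * (t * w / (1 + t * w)) ^ M : ℝ) : ℂ))
      (Set.Ioi 0) := Integrable.ofReal (integrableOn_resolventProfile_mul hs hM hw)
  exact Integrable.mul_const h1 z

end Interpolation

/-! ### Powers of `I - Δ` as superpositions of resolvents; endpoint interpolation -/

section Interpolation

variable {n : ℕ}

local notation "𝔼" => EuclideanSpace ℝ (Fin n)

theorem norm_exp_two_pi_I_mul (a : ℝ) : ‖Complex.exp (2 * Real.pi * Complex.I * (a : ℂ))‖ = 1 := by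
  rw [show 2 * Real.pi * Complex.I * (a : ℂ) = ((2 * Real.pi * a : ℝ) : ℂ) * Complex.I by
    push_cast; ring, Complex.norm_exp_ofReal_mul_I]

theorem SchwartzMap.apply_eq_integral_fourier (h : 𝓢(𝔼, ℂ)) (x : 𝔼) :
    h x = ∫ ξ, (𝓕 h) ξ * Complex.exp (2 * Real.pi * Complex.I * (inner ℝ x ξ : ℝ)) := by
  rw [← SchwartzMap.fourierInv_apply_eq_integral, FourierTransform.fourierInv_fourier_eq]

/-- The Fourier integral of `(1 - (1 + t (I - Δ))⁻¹) ^ M h`. -/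
noncomputable def resolventDifference (M : ℕ) (h : 𝓢(𝔼, ℂ)) (t : ℝ) (x : 𝔼) : ℂ :=
  ∫ ξ, (((t * laplaceSymbol ξ / (1 + t * laplaceSymbol ξ)) ^ M : ℝ) : ℂ) * (𝓕 h) ξ *
    Complex.exp (2 * Real.pi * Complex.I * (inner ℝ x ξ : ℝ))

theorem one_sub_resolventOp_pow_apply {t : ℝ} (ht : 0 ≤ t) (M : ℕ) (h : 𝓢(𝔼, ℂ)) (x : 𝔼) :
    ((1 - resolventOp t) ^ M) h x = resolventDifference M h t x := by
  rw [SchwartzMap.apply_eq_integral_fourier]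
  simp_rw [fourier_one_sub_resolventOp_pow_apply ht]
  rfl

/-- Joint measurability in `(x, t)` is what Tonelli requires; it is read off the Fourier integral,
which is defined for every real `t`. -/
theorem measurable_resolventDifference (M : ℕ) (h : 𝓢(𝔼, ℂ)) :
    Measurable fun q : 𝔼 × ℝ => resolventDifference M h q.2 q.1 := by
  have hw := (continuous_laplaceSymbol (n := n)).measurable
  have hh := (𝓕 h).continuous.measurable
  have : Measurable fun q : (𝔼 × ℝ) × 𝔼 =>
      (((q.1.2 * laplaceSymbol q.2 / (1 + q.1.2 * laplaceSymbol q.2)) ^ M : ℝ) : ℂ) * (𝓕 h) q.2 *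
        Complex.exp (2 * Real.pi * Complex.I * (inner ℝ q.1.1 q.2 : ℝ)) := by
    fun_prop
  exact this.stronglyMeasurable.integral_prod_right'.measurable

/-- The integrand in the representation of `(I - Δ)^{s/2} h` as a superposition of resolvents. -/
noncomputable def resolventIntegrand (s : ℝ) (M : ℕ) (h : 𝓢(𝔼, ℂ)) (x : 𝔼) (q : 𝔼 × ℝ) : ℂ :=
  ((q.2 ^ (-s / 2 - 1) * (q.2 * laplaceSymbol q.1 / (1 + q.2 * laplaceSymbol q.1)) ^ M : ℝ) : ℂ) *
    ((𝓕 h) q.1 * Complex.exp (2 * Real.pi * Complex.I * (inner ℝ x q.1 : ℝ)))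

theorem measurable_resolventIntegrand (s : ℝ) (M : ℕ) (h : 𝓢(𝔼, ℂ)) (x : 𝔼) :
    Measurable (resolventIntegrand s M h x) := by
  have hw : Measurable fun q : 𝔼 × ℝ => laplaceSymbol q.1 :=
    (continuous_laplaceSymbol (n := n)).measurable.comp measurable_fst
  have hh : Measurable fun q : 𝔼 × ℝ => (𝓕 h) q.1 :=
    (𝓕 h).continuous.measurable.comp measurable_fst
  have he : Measurable fun q : 𝔼 × ℝ =>
      Complex.exp (2 * Real.pi * Complex.I * (inner ℝ x q.1 : ℝ)) := by fun_prop
  have h1 : Measurable fun q : 𝔼 × ℝ =>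
      (q.2 * laplaceSymbol q.1 / (1 + q.2 * laplaceSymbol q.1)) ^ M := by fun_prop
  have h2 : Measurable fun q : 𝔼 × ℝ => q.2 ^ (-s / 2 - 1) := by fun_prop
  exact (h2.mul h1).complex_ofReal.mul (hh.mul he)

theorem laplaceSymbol_pos (ξ : 𝔼) : 0 < laplaceSymbol ξ :=
  one_pos.trans_le (one_le_laplaceSymbol ξ)

theorem integral_norm_resolventIntegrand (s : ℝ) (M : ℕ) (h : 𝓢(𝔼, ℂ)) (x ξ : 𝔼) :
    ∫ t in Set.Ioi (0 : ℝ), ‖resolventIntegrand s M h x (ξ, t)‖ =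
      (∫ u in Set.Ioi (0 : ℝ), resolventProfile s M u) * ‖(𝓕 (besselOp s h)) ξ‖ := by
  have hw := laplaceSymbol_pos ξ
  have hcongr : Set.EqOn (fun t : ℝ => ‖resolventIntegrand s M h x (ξ, t)‖)
      (fun t => (t ^ (-s / 2 - 1) * (t * laplaceSymbol ξ / (1 + t * laplaceSymbol ξ)) ^ M)
        * ‖(𝓕 h) ξ‖) (Set.Ioi 0) := by
    intro t (ht : 0 < t)
    simp only [resolventIntegrand, norm_mul, norm_exp_two_pi_I_mul, mul_one]
    rw [Complex.norm_real, Real.norm_eq_abs, abs_of_nonneg (by positivity)]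
  rw [setIntegral_congr_fun measurableSet_Ioi hcongr, integral_mul_const,
    integral_resolventProfile_mul s M hw, fourier_besselOp_apply, norm_mul,
    Complex.norm_real, Real.norm_eq_abs, abs_of_nonneg (by positivity)]
  ring

theorem integral_resolventIntegrand (s : ℝ) (M : ℕ) (h : 𝓢(𝔼, ℂ)) (x ξ : 𝔼) :
    ∫ t in Set.Ioi (0 : ℝ), resolventIntegrand s M h x (ξ, t) =
      ((∫ u in Set.Ioi (0 : ℝ), resolventProfile s M u : ℝ) : ℂ) * ((𝓕 (besselOp s h)) ξ *
        Complex.exp (2 * Real.pi * Complex.I * (inner ℝ x ξ : ℝ))) := by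
  simp only [resolventIntegrand]
  rw [integral_mul_const, integral_complex_ofReal,
    integral_resolventProfile_mul s M (laplaceSymbol_pos ξ), fourier_besselOp_apply]
  push_cast
  ring

/-- Integrating the modulus in `t` first gives a multiple of the modulus of the transform of the
Schwartz function `besselOp s h`, which is integrable. -/
theorem integrable_resolventIntegrand {s : ℝ} (hs : 0 < s) {M : ℕ} (hM : s < 2 * M)
    (h : 𝓢(𝔼, ℂ)) (x : 𝔼) :
    Integrable (resolventIntegrand s M h x)
      ((volume : Measure 𝔼).prod (volume.restrict (Set.Ioi (0 : ℝ)))) := by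
  rw [integrable_prod_iff (measurable_resolventIntegrand s M h x).aestronglyMeasurable]
  constructor
  · refine .of_forall fun ξ => ?_
    have h2 := integrableOn_resolventProfile_mul_complex hs hM (laplaceSymbol_pos ξ)
      ((𝓕 h) ξ * Complex.exp (2 * Real.pi * Complex.I * (inner ℝ x ξ : ℝ)))
    rw [IntegrableOn] at h2
    convert h2 using 2 <;> rfl
  · simp_rw [integral_norm_resolventIntegrand]
    exact (𝓕 (besselOp s h)).integrable.norm.const_mul _

/-- A Balakrishnan-type formula, `c (I - Δ)^{s/2} = ∫₀^∞ t^{-s/2-1} (1 - R_t)^M dt`: the Mellin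
identity for `w^{s/2}` is applied under the Fourier integral and the integrals are exchanged. -/
theorem integral_resolventProfile_mul_besselOp_apply {s : ℝ} (hs : 0 < s) {M : ℕ} (hM : s < 2 * M)
    (h : 𝓢(𝔼, ℂ)) (x : 𝔼) :
    ((∫ u in Set.Ioi (0 : ℝ), resolventProfile s M u : ℝ) : ℂ) * besselOp s h x =
      ∫ t in Set.Ioi (0 : ℝ), ((t ^ (-s / 2 - 1) : ℝ) : ℂ) * resolventDifference M h t x := by
  have hswap := integral_integral_swap (f := fun ξ t => resolventIntegrand s M h x (ξ, t))
    (integrable_resolventIntegrand hs hM h x)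
  simp_rw [integral_resolventIntegrand] at hswap
  rw [integral_const_mul, ← SchwartzMap.apply_eq_integral_fourier] at hswap
  rw [hswap]
  refine integral_congr_ae (.of_forall fun t => ?_)
  simp only [resolventIntegrand, resolventDifference]
  rw [← integral_const_mul]
  refine integral_congr_ae (.of_forall fun ξ => ?_)
  simp only
  push_cast
  ring

theorem enorm_besselOp_apply_le {s : ℝ} (hs : 0 < s) {M : ℕ} (hM : s < 2 * M)
    (h : 𝓢(𝔼, ℂ)) (x : 𝔼) :
    ENNReal.ofReal (∫ u in Set.Ioi (0 : ℝ), resolventProfile s M u) * ‖besselOp s h x‖ₑ ≤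
      ∫⁻ t in Set.Ioi (0 : ℝ), ENNReal.ofReal (t ^ (-s / 2 - 1)) *
        ‖resolventDifference M h t x‖ₑ := by
  have key := congrArg (fun z : ℂ => ‖z‖ₑ) (integral_resolventProfile_mul_besselOp_apply hs hM h x)
  simp only [enorm_mul] at key
  rw [← ofReal_norm, Complex.norm_real, Real.norm_eq_abs,
    abs_of_pos (integral_resolventProfile_pos hs hM)] at key
  rw [key]
  refine (enorm_integral_le_lintegral_enorm _).trans (le_of_eq ?_)
  refine setLIntegral_congr_fun measurableSet_Ioi fun t (ht : 0 < t) => ?_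
  simp only [enorm_mul]
  rw [← ofReal_norm (((t ^ (-s / 2 - 1) : ℝ) : ℂ)), Complex.norm_real, Real.norm_eq_abs,
    abs_of_nonneg (by positivity)]

/-- The set where `|h|` exceeds its essential supremum is open and null, hence empty. A bound at
every point avoids exceptional null sets that vary with `t`. -/
theorem SchwartzMap.enorm_apply_le_eLpNorm_top (h : 𝓢(𝔼, ℂ)) (x : 𝔼) :
    ‖h x‖ₑ ≤ eLpNorm h ∞ volume := by
  have hopen : IsOpen {y : 𝔼 | eLpNorm h ∞ volume < ‖h y‖ₑ} :=
    isOpen_lt continuous_const h.continuous.enorm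
  have hnull : volume {y : 𝔼 | eLpNorm h ∞ volume < ‖h y‖ₑ} = 0 := by
    have := enorm_ae_le_eLpNormEssSup h (volume : Measure 𝔼)
    rw [ae_iff] at this
    simpa [eLpNorm_exponent_top] using this
  replace hnull := (hopen.measure_eq_zero_iff volume).1 hnull
  by_contra hx
  have : x ∈ {y : 𝔼 | eLpNorm h ∞ volume < ‖h y‖ₑ} := not_le.1 hx
  rw [hnull] at this
  exact this

/-- At the two endpoints Minkowski's integral inequality is elementary: Tonelli for `q = 1`, a
pointwise bound for `q = ∞`. -/
theorem eLpNorm_besselOp_le_lintegral {q : ℝ≥0∞} (hq : q = 1 ∨ q = ∞) {s : ℝ} (hs : 0 < s) {M : ℕ}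
    (hM : s < 2 * M) (h : 𝓢(𝔼, ℂ)) :
    ENNReal.ofReal (∫ u in Set.Ioi (0 : ℝ), resolventProfile s M u) *
        eLpNorm (besselOp s h) q volume ≤
      ∫⁻ t in Set.Ioi (0 : ℝ), ENNReal.ofReal (t ^ (-s / 2 - 1)) *
        eLpNorm (((1 - resolventOp t) ^ M) h) q volume := by
  rcases hq with rfl | rfl
  · rw [eLpNorm_one_eq_lintegral_enorm, ← lintegral_const_mul _
      (besselOp s h).continuous.measurable.enorm]
    refine (lintegral_mono fun x => enorm_besselOp_apply_le hs hM h x).trans ?_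
    have hm := measurable_resolventDifference M h
    have hm2 : Measurable fun q : 𝔼 × ℝ => ENNReal.ofReal (q.2 ^ (-s / 2 - 1)) *
        ‖resolventDifference M h q.2 q.1‖ₑ := by fun_prop
    rw [lintegral_lintegral_swap hm2.aemeasurable]
    refine setLIntegral_mono_ae' measurableSet_Ioi (.of_forall fun t (ht : 0 < t) => ?_)
    have hm1 : Measurable fun x : 𝔼 => ‖resolventDifference M h t x‖ₑ :=
      (hm.comp (measurable_id.prodMk measurable_const)).enorm
    rw [lintegral_const_mul _ hm1, eLpNorm_one_eq_lintegral_enorm]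
    simp_rw [one_sub_resolventOp_pow_apply ht.le]
    exact le_rfl
  · rw [eLpNorm_exponent_top, eLpNormEssSup, ← ENNReal.essSup_const_mul]
    refine essSup_le_of_ae_le _ (.of_forall fun x => ?_)
    refine (enorm_besselOp_apply_le hs hM h x).trans ?_
    refine setLIntegral_mono_ae' measurableSet_Ioi (.of_forall fun t (ht : 0 < t) => ?_)
    rw [← one_sub_resolventOp_pow_apply ht.le]
    exact mul_le_mul' le_rfl (SchwartzMap.enorm_apply_le_eLpNorm_top _ x)

theorem eLpNorm_resolventOp_le {q : ℝ≥0∞} (hq : q = 1 ∨ q = ∞) {t : ℝ} (ht : 0 < t)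
    (h : 𝓢(𝔼, ℂ)) : eLpNorm (resolventOp t h) q volume ≤ eLpNorm h q volume := by
  rcases hq with rfl | rfl
  · exact eLpNorm_one_resolventOp_le ht h
  · exact eLpNorm_top_resolventOp_le ht h

theorem lintegral_rpow_Ioc {a τ : ℝ} (ha : 0 < a) (hτ : 0 < τ) :
    ∫⁻ t in Set.Ioc 0 τ, ENNReal.ofReal (t ^ (a - 1)) = ENNReal.ofReal (τ ^ a / a) := by
  have hint : IntegrableOn (fun t : ℝ => t ^ (a - 1)) (Set.Ioc 0 τ) := by
    have := intervalIntegral.intervalIntegrable_rpow' (a := 0) (b := τ) (r := a - 1) (by linarith)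
    rwa [intervalIntegrable_iff_integrableOn_Ioc_of_le hτ.le] at this
  rw [← ofReal_integral_eq_lintegral_ofReal hint, ← intervalIntegral.integral_of_le hτ.le,
    integral_rpow (.inl (by linarith)), sub_add_cancel, Real.zero_rpow ha.ne', sub_zero]
  exact (ae_restrict_iff' measurableSet_Ioc).2 (.of_forall fun t ht => Real.rpow_nonneg ht.1.le _)

theorem lintegral_rpow_Ioi {a τ : ℝ} (ha : 0 < a) (hτ : 0 < τ) :
    ∫⁻ t in Set.Ioi τ, ENNReal.ofReal (t ^ (-a - 1)) = ENNReal.ofReal (τ ^ (-a) / a) := by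
  rw [← ofReal_integral_eq_lintegral_ofReal (integrableOn_Ioi_rpow_of_lt (by linarith) hτ),
    integral_Ioi_rpow_of_lt (by linarith) hτ, sub_add_cancel, neg_div_neg_eq]
  exact (ae_restrict_iff' measurableSet_Ioi).2
    (.of_forall fun t (ht : τ < t) => Real.rpow_nonneg (hτ.trans ht).le _)

/-- An interpolation inequality for `(I - Δ)^{s/2}` in the endpoint spaces `L¹` and `L^∞`. -/
theorem exists_eLpNorm_besselOp_le {s : ℝ} (hs : 0 < s) {M : ℕ} (hM : s < 2 * M) :
    ∃ K : ℝ≥0, ∀ q : ℝ≥0∞, (q = 1 ∨ q = ∞) → ∀ (h : 𝓢(𝔼, ℂ)) (Λ : ℝ), 0 < Λ →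
      eLpNorm (besselOp s h) q volume ≤ K * (ENNReal.ofReal (Λ ^ s) * eLpNorm h q volume +
        ENNReal.ofReal (Λ ^ (s - 2 * M)) * eLpNorm ((besselOp 2 ^ M) h) q volume) := by
  set c := ∫ u in Set.Ioi (0 : ℝ), resolventProfile s M u with hc
  have hc0 : 0 < c := integral_resolventProfile_pos hs hM
  -- The two summands come from `∫₀^τ t^{M-s/2-1} dt` and from `2^M ∫_τ^∞ t^{-s/2-1} dt`.
  set K₁ : ℝ := 1 / (M - s / 2) + 2 ^ M / (s / 2) with hK₁
  have hd : 0 < M - s / 2 := by linarith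
  refine ⟨(K₁ / c).toNNReal, fun q hq h Λ hΛ => ?_⟩
  have hq1 : 1 ≤ q := by rcases hq with rfl | rfl <;> simp
  set A := eLpNorm h q volume
  set B := eLpNorm ((besselOp 2 ^ M) h) q volume
  -- The integral is split at `τ = Λ^{-2}`. Below `τ` the bound `t^M ‖(I - Δ)^M h‖` is used, above
  -- it `2^M ‖h‖`.
  set τ : ℝ := Λ ^ (-2 : ℝ) with hτ
  have hτ0 : 0 < τ := by positivity
  have key : ENNReal.ofReal c * eLpNorm (besselOp s h) q volume ≤
      ENNReal.ofReal K₁ * (ENNReal.ofReal (Λ ^ s) * A + ENNReal.ofReal (Λ ^ (s - 2 * M)) * B) := by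
    refine (eLpNorm_besselOp_le_lintegral hq hs hM h).trans ?_
    rw [← Set.Ioc_union_Ioi_eq_Ioi hτ0.le, lintegral_union measurableSet_Ioi
      (Set.Ioc_disjoint_Ioi le_rfl)]
    have h1 : ∫⁻ t in Set.Ioc 0 τ, ENNReal.ofReal (t ^ (-s / 2 - 1)) *
        eLpNorm (((1 - resolventOp t) ^ M) h) q volume
          ≤ ENNReal.ofReal (1 / (M - s / 2)) * (ENNReal.ofReal (Λ ^ (s - 2 * M)) * B) := by
      calc _ ≤ ∫⁻ t in Set.Ioc 0 τ, ENNReal.ofReal (t ^ ((M - s / 2) - 1)) * B := by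
            refine setLIntegral_mono_ae' measurableSet_Ioc (.of_forall fun t ht => ?_)
            refine (mul_le_mul' le_rfl (eLpNorm_one_sub_resolventOp_pow_le' ht.1.le
              (fun g => eLpNorm_resolventOp_le hq ht.1 g) M h)).trans (le_of_eq ?_)
            rw [← mul_assoc, ← ENNReal.ofReal_mul (Real.rpow_nonneg ht.1.le _),
              ← Real.rpow_natCast t M, ← Real.rpow_add ht.1]
            congr 3
            ring
        _ = _ := by
            rw [lintegral_mul_const _ (by fun_prop), lintegral_rpow_Ioc hd hτ0, ← mul_assoc,
              ← ENNReal.ofReal_mul (by positivity), hτ, ← Real.rpow_mul hΛ.le]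
            congr 2
            rw [div_eq_inv_mul, one_div]
            congr 2
            ring
    have h2 : ∫⁻ t in Set.Ioi τ, ENNReal.ofReal (t ^ (-s / 2 - 1)) *
        eLpNorm (((1 - resolventOp t) ^ M) h) q volume
          ≤ ENNReal.ofReal (2 ^ M / (s / 2)) * (ENNReal.ofReal (Λ ^ s) * A) := by
      calc _ ≤ ∫⁻ t in Set.Ioi τ, ENNReal.ofReal (t ^ (-(s / 2) - 1)) * (2 ^ M * A) := by
            refine setLIntegral_mono_ae' measurableSet_Ioi (.of_forall fun t (ht : τ < t) => ?_)
            rw [neg_div]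
            exact mul_le_mul' le_rfl (eLpNorm_one_sub_resolventOp_pow_le hq1
              (fun g => eLpNorm_resolventOp_le hq (hτ0.trans ht) g) M h)
        _ = _ := by
            rw [lintegral_mul_const _ (by fun_prop), lintegral_rpow_Ioi (by positivity) hτ0,
              hτ, ← Real.rpow_mul hΛ.le, show (-2 : ℝ) * -(s / 2) = s by ring,
              show (2 : ℝ≥0∞) ^ M = ENNReal.ofReal (2 ^ M) by
                rw [ENNReal.ofReal_pow two_pos.le]; simp,
              ← mul_assoc, ← mul_assoc, ← ENNReal.ofReal_mul (by positivity),
              ← ENNReal.ofReal_mul (by positivity)]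
            congr 2
            ring
    refine (add_le_add h1 h2).trans ?_
    rw [mul_add, add_comm]
    gcongr
    · rw [hK₁]; exact le_add_of_nonneg_left (by positivity)
    · rw [hK₁]; exact le_add_of_nonneg_right (by positivity)
  have hcne : ENNReal.ofReal c ≠ 0 := by simpa using hc0
  calc eLpNorm (besselOp s h) q volume
      = (ENNReal.ofReal c)⁻¹ * (ENNReal.ofReal c * eLpNorm (besselOp s h) q volume) := by
        rw [← mul_assoc, ENNReal.inv_mul_cancel hcne ENNReal.ofReal_ne_top, one_mul]
    _ ≤ (ENNReal.ofReal c)⁻¹ * _ := mul_le_mul' le_rfl key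
    _ = _ := by
        rw [← mul_assoc]
        congr 1
        change _ = ENNReal.ofReal (K₁ / c)
        rw [ENNReal.ofReal_div_of_pos hc0, mul_comm, ENNReal.div_eq_inv_mul, mul_comm]

end Interpolation

/-! ### Sobolev norms of oscillatory families -/

section Sobolev

open scoped LineDeriv

variable {n : ℕ}

local notation "𝔼" => EuclideanSpace ℝ (Fin n)

theorem SchwartzMap.fourierInv_apply_eq_fourier_neg (f : 𝓢(𝔼, ℂ)) (ξ : 𝔼) :
    (𝓕⁻ f) ξ = (𝓕 f) (-ξ) := by
  rw [SchwartzMap.fourierInv_coe, Real.fourierInv_eq_fourier_neg]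
  rfl

theorem isBesselImage_besselOp (s : ℝ) (h : 𝓢(𝔼, ℂ)) : IsBesselImage s h (besselOp s h) := by
  intro φ
  have hm := besselSymbol_hasTemperateGrowth (n := n) s
  have e : ∀ f : 𝓢(𝔼, ℂ), besselOp s f = 𝓕⁻ (SchwartzMap.smulLeftCLM ℂ (besselSymbol s) (𝓕 f)) :=
    fun f => SchwartzMap.fourierMultiplierCLM_apply _ _
  rw [e φ, e h, ← SchwartzMap.integral_fourierInv_mul_eq h,
    SchwartzMap.integral_fourierInv_mul_eq _ φ,
    ← integral_neg_eq_self]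
  refine integral_congr_ae (.of_forall fun ξ => ?_)
  have heven : besselSymbol s (-ξ) = besselSymbol s ξ := by simp [besselSymbol]
  simp only [SchwartzMap.smulLeftCLM_apply_apply hm, SchwartzMap.fourierInv_apply_eq_fourier_neg,
    neg_neg, smul_eq_mul, heven]
  ring

/-- The Sobolev norm is an infimum, so for an upper bound one admissible `g` suffices and its
uniqueness plays no role. -/
theorem sobolevNorm_le_eLpNorm_besselOp (r s : ℝ) (h : 𝓢(𝔼, ℂ)) :
    sobolevNorm r s h ≤ eLpNorm (besselOp s h) (ENNReal.ofReal r) volume :=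
  iInf₂_le (besselOp s h : 𝔼 → ℂ)
    ⟨h.memLp _ volume, (besselOp s h).memLp _ volume, isBesselImage_besselOp s h⟩

/-- Integrate `|g|^r ≤ ‖g‖_∞^{r-1} |g|`. This passes from the endpoint bounds to `L^r`. -/
theorem eLpNorm_le_rpow_eLpNorm_top_mul_eLpNorm_one {α : Type*} [MeasurableSpace α] {μ : Measure α}
    {r : ℝ} (hr : 1 < r) {g : α → ℂ} (hg : eLpNorm g ∞ μ ≠ ∞) :
    eLpNorm g (ENNReal.ofReal r) μ ≤ (eLpNorm g ∞ μ ^ (r - 1) * eLpNorm g 1 μ) ^ (1 / r) := by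
  have hr0 : 0 < r := by linarith
  rw [eLpNorm_eq_lintegral_rpow_enorm_toReal (by simpa using hr0) ENNReal.ofReal_ne_top,
    ENNReal.toReal_ofReal hr0.le]
  refine ENNReal.rpow_le_rpow ?_ (by positivity)
  rw [eLpNorm_one_eq_lintegral_enorm]
  have htop := ENNReal.rpow_ne_top_of_nonneg (sub_nonneg.2 hr.le) hg
  rw [← lintegral_const_mul' _ _ htop]
  refine lintegral_mono_ae ?_
  filter_upwards [enorm_ae_le_eLpNormEssSup g μ] with x hx
  have : ‖g x‖ₑ ^ r = ‖g x‖ₑ ^ (r - 1) * ‖g x‖ₑ := by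
    conv_rhs => rw [← ENNReal.rpow_one ‖g x‖ₑ, ← ENNReal.rpow_mul, one_mul]
    rw [← ENNReal.rpow_add_of_nonneg _ _ (by linarith) zero_le_one, sub_add_cancel]
  rw [this, eLpNorm_exponent_top]
  exact mul_le_mul' (ENNReal.rpow_le_rpow hx (by linarith)) le_rfl

theorem fourier_lineDerivOp_apply (m : 𝔼) (f : 𝓢(𝔼, ℂ)) (ξ : 𝔼) :
    (𝓕 (∂_{m} f)) ξ = 2 * Real.pi * Complex.I * (inner ℝ ξ m : ℝ) * (𝓕 f) ξ := by
  rw [SchwartzMap.fourier_lineDerivOp_eq]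
  have : (inner ℝ · m : 𝔼 → ℝ).HasTemperateGrowth := by fun_prop
  simp only [smul_apply, SchwartzMap.smulLeftCLM_apply_apply this, smul_eq_mul,
    Complex.real_smul]
  ring

theorem besselOp_two_apply (h : 𝓢(𝔼, ℂ)) :
    besselOp 2 h = h - ∑ i : Fin n, ∂_{EuclideanSpace.single i (1 : ℝ)}
      (∂_{EuclideanSpace.single i (1 : ℝ)} h) := by
  refine SchwartzMap.ext_fourier fun ξ => ?_
  have hsum : ∀ (F : Fin n → 𝓢(𝔼, ℂ)), (𝓕 (∑ i, F i)) ξ = ∑ i, (𝓕 (F i)) ξ := by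
    intro F
    have : 𝓕 (∑ i, F i) = ∑ i, 𝓕 (F i) := map_sum (FourierTransform.fourierCLM ℂ 𝓢(𝔼, ℂ)) F _
    rw [this, sum_apply]
  rw [fourier_besselOp_two_apply, SchwartzMap.fourier_sub_apply, hsum]
  simp_rw [fourier_lineDerivOp_apply]
  have h2 : ∀ i, (inner ℝ ξ (EuclideanSpace.single i (1 : ℝ)) : ℝ) = ξ i := by
    intro i; simp [EuclideanSpace.inner_single_right]
  simp_rw [h2]
  have h3 : ∀ i, 2 * (Real.pi : ℂ) * Complex.I * (ξ i : ℂ) *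
      (2 * (Real.pi : ℂ) * Complex.I * (ξ i : ℂ) * (𝓕 h) ξ)
        = -(4 * Real.pi ^ 2 * (𝓕 h) ξ) * (((ξ i) ^ 2 : ℝ) : ℂ) := by
    intro i
    have := Complex.I_sq
    push_cast
    linear_combination (4 * (Real.pi : ℂ) ^ 2 * (ξ i : ℂ) ^ 2 * (𝓕 h) ξ) * this
  simp_rw [h3]
  rw [← Finset.mul_sum, ← Complex.ofReal_sum, ← EuclideanSpace.real_norm_sq_eq]
  unfold laplaceSymbol
  push_cast
  ring

variable {q : ℝ≥0∞}

theorem eLpNorm_map_add_le (hq : 1 ≤ q) (T : 𝓢(𝔼, ℂ) →L[ℂ] 𝓢(𝔼, ℂ)) (f g : 𝓢(𝔼, ℂ)) :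
    eLpNorm (T (f + g)) q volume ≤ eLpNorm (T f) q volume + eLpNorm (T g) q volume := by
  rw [map_add]
  exact eLpNorm_add_le (T f).continuous.aestronglyMeasurable
    (T g).continuous.aestronglyMeasurable hq

theorem eLpNorm_map_sub_le (hq : 1 ≤ q) (T : 𝓢(𝔼, ℂ) →L[ℂ] 𝓢(𝔼, ℂ)) (f g : 𝓢(𝔼, ℂ)) :
    eLpNorm (T (f - g)) q volume ≤ eLpNorm (T f) q volume + eLpNorm (T g) q volume := by
  rw [map_sub]
  exact eLpNorm_sub_le (T f).continuous.aestronglyMeasurable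
    (T g).continuous.aestronglyMeasurable hq

theorem eLpNorm_map_smul {N : ℝ} (hN : 0 ≤ N) (T : 𝓢(𝔼, ℂ) →L[ℂ] 𝓢(𝔼, ℂ)) (f : 𝓢(𝔼, ℂ)) :
    eLpNorm (T ((N : ℂ) • f)) q volume = ENNReal.ofReal N * eLpNorm (T f) q volume := by
  rw [map_smul]
  have : ((N : ℂ) • T f : 𝓢(𝔼, ℂ)) = (N : ℂ) • (T f : 𝔼 → ℂ) := rfl
  rw [this, eLpNorm_const_smul, ← ofReal_norm, Complex.norm_real, Real.norm_eq_abs,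
    abs_of_nonneg hN]

theorem eLpNorm_map_sum_le (hq : 1 ≤ q) (T : 𝓢(𝔼, ℂ) →L[ℂ] 𝓢(𝔼, ℂ)) {ι : Type*} (S : Finset ι)
    (F : ι → 𝓢(𝔼, ℂ)) :
    eLpNorm (T (∑ i ∈ S, F i)) q volume ≤ ∑ i ∈ S, eLpNorm (T (F i)) q volume := by
  classical
  induction S using Finset.induction_on with
  | empty =>
    have : ((0 : 𝓢(𝔼, ℂ)) : 𝔼 → ℂ) = 0 := rfl
    simp [this]
  | insert i S hi ih =>
    rw [Finset.sum_insert hi, Finset.sum_insert hi]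
    exact (eLpNorm_map_add_le hq T _ _).trans (by gcongr)

/-- A class of families of Schwartz functions, indexed by a frequency parameter, such that every
partial derivative costs at most one factor of the parameter. -/
def IsOscillatory (B : Set (ℝ → 𝓢(𝔼, ℂ))) : Prop :=
  ∀ u ∈ B, ∀ i : Fin n, ∃ a ∈ B, ∃ b ∈ B, ∀ N : ℝ,
    ∂_{EuclideanSpace.single i (1 : ℝ)} (u N) = a N + (N : ℂ) • b N

/-- Each `I - Δ` takes two derivatives, hence costs at most `N²`. As derivatives stay in the class,
the induction runs over all its members at once. -/
theorem IsOscillatory.exists_eLpNorm_besselOp_two_pow_le {B : Set (ℝ → 𝓢(𝔼, ℂ))}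
    (hB : IsOscillatory B) (hq : 1 ≤ q) (A : ℝ → ℝ≥0∞)
    (hA : ∀ u ∈ B, ∃ C : ℝ≥0, ∀ N : ℝ, 1 ≤ N → eLpNorm (u N) q volume ≤ C * A N) (m : ℕ) :
    ∀ u ∈ B, ∃ C : ℝ≥0, ∀ N : ℝ, 1 ≤ N →
      eLpNorm ((besselOp 2 ^ m) (u N)) q volume ≤ C * ENNReal.ofReal N ^ (2 * m) * A N := by
  induction m with
  | zero => simpa using hA
  | succ m ih =>
    intro u hu
    choose a haB b hbB hab using hB u hu
    choose aa haaB ab habB haab using fun i => hB (a i) (haB i) i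
    choose ba hbaB bb hbbB hbab using fun i => hB (b i) (hbB i) i
    obtain ⟨C₀, hC₀⟩ := ih u hu
    choose C₁ hC₁ using fun i => ih (aa i) (haaB i)
    choose C₂ hC₂ using fun i => ih (ab i) (habB i)
    choose C₃ hC₃ using fun i => ih (ba i) (hbaB i)
    choose C₄ hC₄ using fun i => ih (bb i) (hbbB i)
    refine ⟨C₀ + ∑ i, ((C₁ i + C₂ i) + (C₃ i + C₄ i)), fun N hN => ?_⟩
    have hN0 : 0 ≤ N := by linarith
    set X := ENNReal.ofReal N with hX
    have hX1 : 1 ≤ X := by rw [hX]; simpa using hN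
    set Y := X ^ (2 * (m + 1)) * A N with hY
    set T := (besselOp (n := n) 2) ^ m with hT
    have hmono : ∀ j : ℕ, j ≤ 2 → X ^ j * (X ^ (2 * m) * A N) ≤ Y := by
      intro j hj
      rw [hY, ← mul_assoc, ← pow_add]
      exact mul_le_mul' (pow_le_pow_right₀ hX1 (by omega)) le_rfl
    have hterm : ∀ (j : ℕ) (_ : j ≤ 2) (C : ℝ≥0) (v : 𝓢(𝔼, ℂ)),
        eLpNorm (T v) q volume ≤ C * X ^ (2 * m) * A N →
        X ^ j * eLpNorm (T v) q volume ≤ C * Y := by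
      intro j hj C v hv
      calc X ^ j * eLpNorm (T v) q volume ≤ X ^ j * (C * X ^ (2 * m) * A N) := by gcongr
        _ = C * (X ^ j * (X ^ (2 * m) * A N)) := by ring
        _ ≤ C * Y := by gcongr; exact hmono j hj
    have hd : ∀ i, eLpNorm (T (∂_{EuclideanSpace.single i (1 : ℝ)}
        (∂_{EuclideanSpace.single i (1 : ℝ)} (u N)))) q volume
          ≤ ((C₁ i + C₂ i) + (C₃ i + C₄ i)) * Y := by
      intro i
      have e : ∂_{EuclideanSpace.single i (1 : ℝ)} (∂_{EuclideanSpace.single i (1 : ℝ)} (u N))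
          = (aa i N + (N : ℂ) • ab i N) + (N : ℂ) • (ba i N + (N : ℂ) • bb i N) := by
        rw [hab, LineDeriv.lineDerivOp_add, LineDeriv.lineDerivOp_smul, haab, hbab]
      rw [e, add_mul, add_mul, add_mul]
      refine (eLpNorm_map_add_le hq T _ _).trans (add_le_add ?_ ?_)
      · refine (eLpNorm_map_add_le hq T _ _).trans (add_le_add ?_ ?_)
        · simpa using hterm 0 (by norm_num) _ _ (hC₁ i N hN)
        · rw [eLpNorm_map_smul hN0]
          simpa using hterm 1 (by norm_num) _ _ (hC₂ i N hN)
      · rw [eLpNorm_map_smul hN0]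
        refine (mul_le_mul' le_rfl (eLpNorm_map_add_le hq T _ _)).trans ?_
        rw [mul_add]
        refine add_le_add ?_ ?_
        · simpa using hterm 1 (by norm_num) _ _ (hC₃ i N hN)
        · rw [eLpNorm_map_smul hN0, ← mul_assoc, ← pow_two]
          exact hterm 2 le_rfl _ _ (hC₄ i N hN)
    rw [pow_succ, mul_apply_eq_comp, besselOp_two_apply, mul_assoc]
    refine (eLpNorm_map_sub_le hq T _ _).trans ?_
    push_cast
    rw [add_mul, Finset.sum_mul]
    refine add_le_add ?_ ?_
    · simpa using hterm 0 (by norm_num) _ _ (hC₀ N hN)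
    · exact (eLpNorm_map_sum_le hq T _ _).trans (Finset.sum_le_sum fun i _ => hd i)

theorem IsOscillatory.exists_eLpNorm_besselOp_le {B : Set (ℝ → 𝓢(𝔼, ℂ))}
    (hB : IsOscillatory B) (hq : q = 1 ∨ q = ∞) (A : ℝ → ℝ≥0∞)
    (hA : ∀ u ∈ B, ∃ C : ℝ≥0, ∀ N : ℝ, 1 ≤ N → eLpNorm (u N) q volume ≤ C * A N)
    {s : ℝ} (hs : 0 < s) {u : ℝ → 𝓢(𝔼, ℂ)} (hu : u ∈ B) :
    ∃ C : ℝ≥0, ∀ N : ℝ, 1 ≤ N →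
      eLpNorm (besselOp s (u N)) q volume ≤ C * ENNReal.ofReal (N ^ s) * A N := by
  have hq1 : 1 ≤ q := by rcases hq with rfl | rfl <;> simp
  obtain ⟨M, hM⟩ := exists_nat_gt (s / 2)
  obtain ⟨K, hK⟩ := _root_.exists_eLpNorm_besselOp_le (n := n) hs (M := M) (by linarith)
  obtain ⟨C₀, hC₀⟩ := hA u hu
  obtain ⟨C₁, hC₁⟩ := hB.exists_eLpNorm_besselOp_two_pow_le hq1 A hA M u hu
  refine ⟨K * (C₀ + C₁), fun N hN => ?_⟩
  have hN0 : 0 < N := by linarith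
  -- Interpolation at `Λ = N`, where `N^{s-2M} · N^{2M} = N^s` makes both terms equally large.
  refine (hK q hq (u N) N hN0).trans ?_
  calc _ ≤ K * (ENNReal.ofReal (N ^ s) * (C₀ * A N) + ENNReal.ofReal (N ^ (s - 2 * M)) *
        (C₁ * ENNReal.ofReal N ^ (2 * M) * A N)) := by
        gcongr
        · exact hC₀ N hN
        · exact hC₁ N hN
    _ = _ := by
        have : ENNReal.ofReal (N ^ (s - 2 * M)) * ENNReal.ofReal N ^ (2 * M)
            = ENNReal.ofReal (N ^ s) := by
          rw [← ENNReal.ofReal_pow hN0.le, ← ENNReal.ofReal_mul (by positivity),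
            ← Real.rpow_natCast N, ← Real.rpow_add hN0]
          congr 2
          push_cast
          ring
        rw [← this]
        push_cast
        ring

/-- Sobolev norms of oscillatory families, with the expected power of the frequency. -/
theorem IsOscillatory.exists_sobolevNorm_le {B : Set (ℝ → 𝓢(𝔼, ℂ))}
    (hB : IsOscillatory B) (κ : ℝ)
    (hA : ∀ u ∈ B, ∃ C : ℝ≥0, ∀ N : ℝ, 1 ≤ N → eLpNorm (u N) ∞ volume ≤ C)
    (hA' : ∀ u ∈ B, ∃ C : ℝ≥0, ∀ N : ℝ, 1 ≤ N →
      eLpNorm (u N) 1 volume ≤ C * ENNReal.ofReal (N ^ (-κ)))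
    {r s : ℝ} (hr : 1 < r) (hs : 0 < s) {u : ℝ → 𝓢(𝔼, ℂ)} (hu : u ∈ B) :
    ∃ C : ℝ≥0, ∀ N : ℝ, 1 ≤ N →
      sobolevNorm r s (u N) ≤ C * ENNReal.ofReal (N ^ (s - κ / r)) := by
  obtain ⟨C₁, hC₁⟩ := hB.exists_eLpNorm_besselOp_le (.inr rfl) (fun _ => 1)
    (by simpa using hA) hs hu
  obtain ⟨C₂, hC₂⟩ := hB.exists_eLpNorm_besselOp_le (.inl rfl) _ hA' hs hu
  have hr0 : 0 < r := by linarith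
  refine ⟨(C₁ ^ (r - 1) * C₂) ^ (1 / r), fun N hN => ?_⟩
  have hN0 : 0 < N := by linarith
  refine (sobolevNorm_le_eLpNorm_besselOp r s (u N)).trans
    ((eLpNorm_le_rpow_eLpNorm_top_mul_eLpNorm_one hr
      ((besselOp s (u N)).memLp ∞ volume).eLpNorm_ne_top).trans ?_)
  have h1 := hC₁ N hN
  rw [mul_one] at h1
  calc _ ≤ ((C₁ * ENNReal.ofReal (N ^ s)) ^ (r - 1) *
        (C₂ * ENNReal.ofReal (N ^ s) * ENNReal.ofReal (N ^ (-κ)))) ^ (1 / r) := by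
        gcongr
        exact hC₂ N hN
    _ = ((C₁ ^ (r - 1) * C₂) * ENNReal.ofReal (N ^ (s * r - κ))) ^ (1 / r) := by
        congr 1
        rw [ENNReal.mul_rpow_of_nonneg _ _ (by linarith),
          ENNReal.ofReal_rpow_of_pos (by positivity), ← Real.rpow_mul hN0.le]
        have : N ^ (s * r - κ) = N ^ (s * (r - 1)) * (N ^ s * N ^ (-κ)) := by
          rw [← Real.rpow_add hN0, ← Real.rpow_add hN0]; congr 1; ring
        rw [this, ENNReal.ofReal_mul (by positivity), ENNReal.ofReal_mul (by positivity)]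
        ring
    _ = _ := by
        rw [ENNReal.mul_rpow_of_nonneg _ _ (by positivity),
          ENNReal.ofReal_rpow_of_pos (by positivity), ← Real.rpow_mul hN0.le,
          ENNReal.coe_rpow_of_nonneg _ (by positivity), ENNReal.coe_mul,
          ENNReal.coe_rpow_of_nonneg _ (by linarith)]
        congr 3
        field_simp

end Sobolev

/-! ### The two test families: chirps and bumps -/

section Families

open scoped LineDeriv

variable {n : ℕ}

local notation "𝔼" => EuclideanSpace ℝ (Fin n)

theorem hasTemperateGrowth_cexp_ofReal_mul_I :
    (fun t : ℝ => Complex.exp (t * Complex.I)).HasTemperateGrowth := by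
  refine ⟨?_, fun m => ⟨0, 1, fun t => ?_⟩⟩
  · exact (Complex.ofRealCLM.contDiff.mul contDiff_const).cexp
  · have h : ∀ m : ℕ, iteratedDeriv m (fun t : ℝ => Complex.exp (t * Complex.I))
        = fun t : ℝ => Complex.I ^ m * Complex.exp (t * Complex.I) := by
      intro m
      induction m with
      | zero => simp
      | succ m ih =>
        rw [iteratedDeriv_succ, ih]
        funext t
        have h1 : HasDerivAt (fun t : ℝ => (t : ℂ) * Complex.I) (1 * Complex.I) t :=
          Complex.ofRealCLM.hasDerivAt.mul_const _
        have h2 := (h1.cexp.const_mul (Complex.I ^ m)).deriv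
        rw [h2, pow_succ]
        ring
    rw [norm_iteratedFDeriv_eq_norm_iteratedDeriv, h]
    simp [Complex.norm_exp_ofReal_mul_I]

/-- The chirp `exp (i a ‖ξ‖ ^ 2)`. -/
noncomputable def chirp (a : ℝ) (ξ : 𝔼) : ℂ := Complex.exp ((a * ‖ξ‖ ^ 2 : ℝ) * Complex.I)

theorem chirp_hasTemperateGrowth (a : ℝ) : (chirp (n := n) a).HasTemperateGrowth := by
  have h2 : Function.HasTemperateGrowth (fun ξ : 𝔼 => a * ‖ξ‖ ^ 2) := by fun_prop
  exact hasTemperateGrowth_cexp_ofReal_mul_I.comp h2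

theorem norm_chirp (a : ℝ) (ξ : 𝔼) : ‖chirp a ξ‖ = 1 := Complex.norm_exp_ofReal_mul_I _

theorem chirp_smul (a μ : ℝ) (ξ : 𝔼) : chirp a (μ • ξ) = chirp (μ ^ 2 * a) ξ := by
  unfold chirp
  rw [norm_smul, mul_pow, Real.norm_eq_abs, sq_abs]
  congr 3
  ring

theorem hasFDerivAt_chirp (a : ℝ) (ξ : 𝔼) :
    HasFDerivAt (chirp a) ((2 * a * Complex.I * chirp a ξ) •
      (Complex.ofRealCLM.comp (innerSL ℝ ξ))) ξ := by
  have h1 : HasFDerivAt (fun ξ : 𝔼 => a * ‖ξ‖ ^ 2) (a • (2 • (innerSL ℝ ξ))) ξ := by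
    have := (hasStrictFDerivAt_norm_sq ξ).hasFDerivAt.const_mul a
    exact this
  have h2 := ((Complex.ofRealCLM.hasFDerivAt (x := a * ‖ξ‖ ^ 2)).comp ξ h1).mul_const Complex.I
  have h3 := h2.cexp
  refine h3.congr_fderiv ?_
  ext v
  simp only [Function.comp_def, chirp, Complex.ofRealCLM_apply, smul_apply,
    ContinuousLinearMap.comp_apply, smul_eq_mul, nsmul_eq_mul]
  push_cast
  ring

theorem SchwartzMap.lineDerivOp_smulLeftCLM_apply {g : 𝔼 → ℂ} (hg : g.HasTemperateGrowth)
    (c : 𝓢(𝔼, ℂ)) (m ξ : 𝔼) {g' : 𝔼 →L[ℝ] ℂ} (hg' : HasFDerivAt g g' ξ) :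
    (∂_{m} (SchwartzMap.smulLeftCLM ℂ g c)) ξ = g ξ * (∂_{m} c) ξ + g' m * c ξ := by
  rw [SchwartzMap.lineDerivOp_apply_eq_fderiv, SchwartzMap.lineDerivOp_apply_eq_fderiv]
  have h1 : (SchwartzMap.smulLeftCLM ℂ g c : 𝔼 → ℂ) = g * ⇑c := by
    funext ξ
    rw [SchwartzMap.smulLeftCLM_apply_apply hg, smul_eq_mul, Pi.mul_apply]
  rw [h1, (hg'.mul (c.hasFDerivAt ξ)).fderiv]
  simp only [add_apply, smul_apply, smul_eq_mul]
  ring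

/-- Differentiating the chirp produces `2 i lam N ξ_i`. The factor `ξ_i` is absorbed into the
amplitude, which is why the class allows every Schwartz amplitude. -/
theorem isOscillatory_chirp (lam : ℝ) : IsOscillatory (Set.range
    fun (c : 𝓢(𝔼, ℂ)) (N : ℝ) => SchwartzMap.smulLeftCLM ℂ (chirp (lam * N)) c) := by
  rintro _ ⟨c, rfl⟩ i
  set m : 𝔼 := EuclideanSpace.single i (1 : ℝ) with hm
  have hin : (fun ξ : 𝔼 => 2 * lam * Complex.I * (inner ℝ ξ m : ℝ)).HasTemperateGrowth := by
    fun_prop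
  refine ⟨_, ⟨∂_{m} c, rfl⟩, _,
    ⟨SchwartzMap.smulLeftCLM ℂ (fun ξ : 𝔼 => 2 * lam * Complex.I * (inner ℝ ξ m : ℝ)) c, rfl⟩,
    fun N => SchwartzMap.ext fun ξ => ?_⟩
  have hc := chirp_hasTemperateGrowth (n := n) (lam * N)
  rw [SchwartzMap.lineDerivOp_smulLeftCLM_apply hc c m ξ (hasFDerivAt_chirp _ _)]
  simp only [add_apply, smul_apply, SchwartzMap.smulLeftCLM_apply_apply hc,
    SchwartzMap.smulLeftCLM_apply_apply hin, smul_eq_mul, ContinuousLinearMap.comp_apply,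
    Complex.ofRealCLM_apply, innerSL_apply_apply]
  push_cast
  ring

theorem eLpNorm_smulLeftCLM_chirp (a : ℝ) (c : 𝓢(𝔼, ℂ)) (q : ℝ≥0∞) :
    eLpNorm (SchwartzMap.smulLeftCLM ℂ (chirp a) c) q volume = eLpNorm c q volume := by
  refine eLpNorm_congr_norm_ae (.of_forall fun ξ => ?_)
  rw [SchwartzMap.smulLeftCLM_apply_apply (chirp_hasTemperateGrowth a), norm_smul, norm_chirp,
    one_mul]

theorem exists_sobolevNorm_chirp_le {r s : ℝ} (hr : 1 < r) (hs : 0 < s) (lam : ℝ)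
    (c : 𝓢(𝔼, ℂ)) :
    ∃ C : ℝ≥0, ∀ N : ℝ, 1 ≤ N → sobolevNorm r s (fun ξ => chirp (lam * N) ξ * c ξ)
      ≤ C * ENNReal.ofReal (N ^ s) := by
  have hb : ∀ q : ℝ≥0∞, ∀ u ∈ (Set.range fun (c : 𝓢(𝔼, ℂ)) (N : ℝ) =>
      SchwartzMap.smulLeftCLM ℂ (chirp (lam * N)) c), ∃ C : ℝ≥0, ∀ N : ℝ, 1 ≤ N →
        eLpNorm (u N) q volume ≤ C := by
    rintro q _ ⟨c, rfl⟩
    refine ⟨(eLpNorm c q volume).toNNReal, fun N _ => ?_⟩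
    rw [eLpNorm_smulLeftCLM_chirp, ENNReal.coe_toNNReal (c.memLp q volume).eLpNorm_ne_top]
  obtain ⟨C, hC⟩ := (isOscillatory_chirp (n := n) lam).exists_sobolevNorm_le 0 (hb ∞)
    (by simpa using hb 1) hr hs ⟨c, rfl⟩
  refine ⟨C, fun N hN => ?_⟩
  have := hC N hN
  rw [zero_div, sub_zero] at this
  convert! this using 2
  funext ξ
  rw [SchwartzMap.smulLeftCLM_apply_apply (chirp_hasTemperateGrowth _), smul_eq_mul]

theorem hasTemperateGrowth_comp_affine (φ : 𝓢(𝔼, ℂ)) (N μ : ℝ) (ξ₀ : 𝔼) :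
    (fun ξ : 𝔼 => φ (N • (μ • ξ - ξ₀))).HasTemperateGrowth := by
  have h2 : Function.HasTemperateGrowth (fun ξ : 𝔼 => N • (μ • ξ - ξ₀)) := by fun_prop
  exact φ.hasTemperateGrowth.comp h2

/-- The derivative falls either on the fixed factor, at no cost, or on the bump, at cost `N` with a
new profile `μ ∂φ`. Hence pairs of Schwartz functions. -/
theorem isOscillatory_bump (μ : ℝ) (ξ₀ : 𝔼) : IsOscillatory (Set.range
    fun (q : 𝓢(𝔼, ℂ) × 𝓢(𝔼, ℂ)) (N : ℝ) =>
      SchwartzMap.smulLeftCLM ℂ (fun ξ => q.1 (N • (μ • ξ - ξ₀))) q.2) := by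
  rintro _ ⟨⟨φ, c⟩, rfl⟩ i
  set m : 𝔼 := EuclideanSpace.single i (1 : ℝ) with hm
  refine ⟨_, ⟨(φ, ∂_{m} c), rfl⟩, _, ⟨((μ : ℂ) • ∂_{m} φ, c), rfl⟩,
    fun N => SchwartzMap.ext fun ξ => ?_⟩
  have hg := hasTemperateGrowth_comp_affine φ N μ ξ₀
  have hg2 := hasTemperateGrowth_comp_affine ((μ : ℂ) • ∂_{m} φ) N μ ξ₀
  have haff : HasFDerivAt (fun ξ : 𝔼 => N • (μ • ξ - ξ₀))
      (N • (μ • ContinuousLinearMap.id ℝ 𝔼)) ξ :=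
    (((hasFDerivAt_id ξ).const_smul μ).sub_const ξ₀).const_smul N
  have hd : HasFDerivAt (fun ξ : 𝔼 => φ (N • (μ • ξ - ξ₀)))
      ((fderiv ℝ φ (N • (μ • ξ - ξ₀))).comp (N • (μ • ContinuousLinearMap.id ℝ 𝔼))) ξ :=
    (φ.hasFDerivAt _).comp ξ haff
  simp only
  rw [SchwartzMap.lineDerivOp_smulLeftCLM_apply hg c m ξ hd, add_apply, smul_apply,
    SchwartzMap.smulLeftCLM_apply_apply hg, SchwartzMap.smulLeftCLM_apply_apply hg2]
  simp only [smul_apply, smul_eq_mul, ContinuousLinearMap.comp_apply,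
    ContinuousLinearMap.id_apply, map_smul, SchwartzMap.lineDerivOp_apply_eq_fderiv,
    Complex.real_smul]
  ring

theorem lintegral_enorm_comp_affine {N μ : ℝ} (hN : 0 < N) (hμ : 0 < μ) (ξ₀ : 𝔼) (φ : 𝓢(𝔼, ℂ)) :
    ∫⁻ ξ : 𝔼, ‖φ (N • (μ • ξ - ξ₀))‖ₑ
      = ENNReal.ofReal (μ ^ n)⁻¹ * ENNReal.ofReal (N ^ (-(n : ℝ))) * ∫⁻ ξ, ‖φ ξ‖ₑ := by
  have hmul : ∀ ξ : 𝔼, N • (μ • ξ - ξ₀) = (N * μ) • ξ - N • ξ₀ := by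
    intro ξ; rw [smul_sub, smul_smul]
  simp_rw [hmul]
  have hne : N * μ ≠ 0 := by positivity
  have hφ : Measurable fun ξ : 𝔼 => ‖φ (ξ - N • ξ₀)‖ₑ := by
    have := φ.continuous
    exact (Continuous.enorm (by fun_prop)).measurable
  have h1 := lintegral_map (μ := (volume : Measure 𝔼)) hφ (measurable_const_smul (N * μ))
  rw [← h1, Measure.map_addHaar_smul volume hne, lintegral_smul_measure,
    lintegral_sub_right_eq_self (fun ξ : 𝔼 => ‖φ ξ‖ₑ), smul_eq_mul, finrank_euclideanSpace_fin,
    abs_of_pos (by positivity), ← ENNReal.ofReal_mul (by positivity), mul_pow, mul_inv,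
    Real.rpow_neg hN.le, Real.rpow_natCast, mul_comm (N ^ n)⁻¹]

/-- Sup norms stay bounded while `L¹` norms decay like `N^{-n}`, so the general bound applies with
`κ = n`. -/
theorem exists_sobolevNorm_bump_le {r s : ℝ} (hr : 1 < r) (hs : 0 < s) {μ : ℝ} (hμ : 0 < μ)
    (ξ₀ : 𝔼) (φ c : 𝓢(𝔼, ℂ)) :
    ∃ C : ℝ≥0, ∀ N : ℝ, 1 ≤ N → sobolevNorm r s (fun ξ => φ (N • (μ • ξ - ξ₀)) * c ξ)
      ≤ C * ENNReal.ofReal (N ^ (s - n / r)) := by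
  have hpt : ∀ (f : 𝓢(𝔼, ℂ)) (ξ : 𝔼), ‖f ξ‖ₑ ≤ (eLpNorm f ∞ volume).toNNReal := by
    intro f ξ
    rw [ENNReal.coe_toNNReal (f.memLp ∞ volume).eLpNorm_ne_top]
    exact f.enorm_apply_le_eLpNorm_top ξ
  have h0 : ∀ (q : 𝓢(𝔼, ℂ) × 𝓢(𝔼, ℂ)) (N : ℝ) (ξ : 𝔼),
      SchwartzMap.smulLeftCLM ℂ (fun ξ => q.1 (N • (μ • ξ - ξ₀))) q.2 ξ
        = q.1 (N • (μ • ξ - ξ₀)) * q.2 ξ := by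
    intro q N ξ
    rw [SchwartzMap.smulLeftCLM_apply_apply (hasTemperateGrowth_comp_affine _ _ _ _), smul_eq_mul]
  set B := Set.range fun (q : 𝓢(𝔼, ℂ) × 𝓢(𝔼, ℂ)) (N : ℝ) =>
    SchwartzMap.smulLeftCLM ℂ (fun ξ => q.1 (N • (μ • ξ - ξ₀))) q.2 with hB
  have hA : ∀ u ∈ B, ∃ C : ℝ≥0, ∀ N : ℝ, 1 ≤ N → eLpNorm (u N) ∞ volume ≤ C := by
    rintro _ ⟨q, rfl⟩
    refine ⟨(eLpNorm q.1 ∞ volume).toNNReal * (eLpNorm q.2 ∞ volume).toNNReal, fun N _ => ?_⟩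
    rw [eLpNorm_exponent_top]
    refine essSup_le_of_ae_le _ (.of_forall fun ξ => ?_)
    simp only [h0, enorm_mul, ENNReal.coe_mul]
    exact mul_le_mul' (hpt _ _) (hpt _ _)
  have hA' : ∀ u ∈ B, ∃ C : ℝ≥0, ∀ N : ℝ, 1 ≤ N →
      eLpNorm (u N) 1 volume ≤ C * ENNReal.ofReal (N ^ (-(n : ℝ))) := by
    rintro _ ⟨q, rfl⟩
    refine ⟨(μ ^ n)⁻¹.toNNReal * (eLpNorm q.1 1 volume).toNNReal *
      (eLpNorm q.2 ∞ volume).toNNReal, fun N hN => ?_⟩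
    rw [eLpNorm_one_eq_lintegral_enorm]
    simp only [h0, enorm_mul]
    refine (lintegral_mono fun ξ => mul_le_mul' le_rfl (hpt q.2 ξ)).trans (le_of_eq ?_)
    rw [lintegral_mul_const' _ _ ENNReal.coe_ne_top,
      lintegral_enorm_comp_affine (by linarith) hμ, ENNReal.coe_mul, ENNReal.coe_mul,
      ENNReal.coe_toNNReal (q.1.memLp 1 volume).eLpNorm_ne_top, eLpNorm_one_eq_lintegral_enorm,
      ENNReal.ofReal]
    ring
  obtain ⟨C, hC⟩ := (isOscillatory_bump (n := n) μ ξ₀).exists_sobolevNorm_le n hA hA' hr hs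
    ⟨(φ, c), rfl⟩
  refine ⟨C, fun N hN => ?_⟩
  convert! hC N hN using 2
  funext ξ
  exact (h0 (φ, c) N ξ).symm

theorem sobolevNorm_zero (r s : ℝ) : sobolevNorm r s (fun _ : 𝔼 => 0) = 0 := by
  have h := sobolevNorm_le_eLpNorm_besselOp r s (0 : 𝓢(𝔼, ℂ))
  have e : ((0 : 𝓢(𝔼, ℂ)) : 𝔼 → ℂ) = fun _ => 0 := rfl
  rw [map_zero, e] at h
  refine le_antisymm (h.trans ?_) (zero_le)
  have : (fun _ : 𝔼 => (0 : ℂ)) = 0 := rfl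
  rw [this, eLpNorm_zero]

/-- The radii of the annulus have ratio `4`, so dilating it by `2^k` with `|k| ≥ 2` makes it
disjoint from itself. -/
theorem IsDyadicPartition.mul_eq_zero {Ψ : 𝓢(𝔼, ℂ)} (hΨ : IsDyadicPartition Ψ) {k : ℤ}
    (hk : k ∉ Finset.Icc (-1 : ℤ) 1) (ξ : 𝔼) : (𝓕 Ψ) ((2 : ℝ) ^ k • ξ) * (𝓕 Ψ) ξ = 0 := by
  by_contra hne
  obtain ⟨h1, h2⟩ := mul_ne_zero_iff.1 hne
  obtain ⟨a1, a2⟩ := hΨ.1 _ h1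
  obtain ⟨b1, b2⟩ := hΨ.1 _ h2
  have hpos : (0 : ℝ) < 2 ^ k := by positivity
  rw [norm_smul, Real.norm_eq_abs, abs_of_pos hpos] at a1 a2
  rw [Finset.mem_Icc, not_and_or, not_le, not_le] at hk
  rcases hk with hk | hk
  · have : (2 : ℝ) ^ k ≤ 2 ^ (-2 : ℤ) := zpow_le_zpow_right₀ one_le_two (by omega)
    norm_num at this
    nlinarith [norm_nonneg ξ]
  · have : (2 : ℝ) ^ (2 : ℤ) ≤ 2 ^ k := zpow_le_zpow_right₀ one_le_two (by omega)
    norm_num at this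
    nlinarith [norm_nonneg ξ]

/-- Only the three scales `|k| ≤ 1` matter for symbols that are localized by `Ψ̂`. -/
theorem IsDyadicPartition.exists_hormanderNorm_le {Ψ : 𝓢(𝔼, ℂ)} (hΨ : IsDyadicPartition Ψ)
    {r s γ : ℝ} (e : ℝ → 𝔼 → ℂ)
    (he : ∀ (μ : ℝ), 0 < μ → ∀ c : 𝓢(𝔼, ℂ), ∃ C : ℝ≥0, ∀ N : ℝ, 1 ≤ N →
      sobolevNorm r s (fun ξ => e N (μ • ξ) * c ξ) ≤ C * ENNReal.ofReal (N ^ γ)) :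
    ∃ C : ℝ≥0, ∀ N : ℝ, 1 ≤ N →
      hormanderNorm Ψ r s (fun ξ => e N ξ * (𝓕 Ψ) ξ) ≤ C * ENNReal.ofReal (N ^ γ) := by
  have hg : ∀ k : ℤ, (fun ξ : 𝔼 => (𝓕 Ψ) ((2 : ℝ) ^ k • ξ)).HasTemperateGrowth := by
    intro k
    have h2 : Function.HasTemperateGrowth (fun ξ : 𝔼 => (2 : ℝ) ^ k • ξ) := by fun_prop
    exact (𝓕 Ψ).hasTemperateGrowth.comp h2
  -- At scale `k` the factor `Ψ̂(2^k ξ) Ψ̂(ξ)` is one fixed Schwartz amplitude, and the dilation is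
  -- `μ = 2^k`.
  choose C hC using fun k : ℤ => he ((2 : ℝ) ^ k) (by positivity)
    (SchwartzMap.smulLeftCLM ℂ (fun ξ : 𝔼 => (𝓕 Ψ) ((2 : ℝ) ^ k • ξ)) (𝓕 Ψ))
  refine ⟨∑ k ∈ Finset.Icc (-1 : ℤ) 1, C k, fun N hN => iSup_le fun k => ?_⟩
  by_cases hk : k ∈ Finset.Icc (-1 : ℤ) 1
  · have h1 := hC k N hN
    simp only [SchwartzMap.smulLeftCLM_apply_apply (hg k), smul_eq_mul, ← mul_assoc] at h1
    refine h1.trans ?_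
    gcongr
    exact Finset.single_le_sum (f := C) (fun _ _ => zero_le) hk
  · have : (fun ξ : 𝔼 => e N ((2 : ℝ) ^ k • ξ) * (𝓕 Ψ) ((2 : ℝ) ^ k • ξ) * (𝓕 Ψ) ξ)
        = fun _ => 0 := by
      funext ξ
      rw [mul_assoc, hΨ.mul_eq_zero hk, mul_zero]
    rw [this, sobolevNorm_zero]
    exact zero_le

/-- On the unit sphere every term with `j ≠ 0` is evaluated outside the open annulus, so the sum
reduces to `j = 0`. -/
theorem IsDyadicPartition.fourier_eq_one {Ψ : 𝓢(𝔼, ℂ)} (hΨ : IsDyadicPartition Ψ) {ξ : 𝔼}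
    (hξ : ‖ξ‖ = 1) : (𝓕 Ψ) ξ = 1 := by
  have h0 : ξ ≠ 0 := by rintro rfl; simp at hξ
  have h1 := hΨ.2 ξ h0
  have h2 : HasSum (fun j : ℤ => (𝓕 Ψ) ((2 : ℝ) ^ (-j) • ξ))
      ((𝓕 Ψ) ((2 : ℝ) ^ (-(0 : ℤ)) • ξ)) := by
    refine hasSum_single 0 fun j hj => ?_
    by_contra hne
    obtain ⟨a1, a2⟩ := hΨ.1 _ hne
    have hpos : (0 : ℝ) < 2 ^ (-j) := by positivity
    rw [norm_smul, Real.norm_eq_abs, abs_of_pos hpos, hξ, mul_one] at a1 a2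
    rcases lt_or_gt_of_ne hj with hj | hj
    · have : (2 : ℝ) ^ (1 : ℤ) ≤ 2 ^ (-j) := zpow_le_zpow_right₀ one_le_two (by omega)
      norm_num at this a2
      linarith
    · have : (2 : ℝ) ^ (-j) ≤ 2 ^ (-1 : ℤ) := zpow_le_zpow_right₀ one_le_two (by omega)
      norm_num at this a1
      linarith
  have := h2.unique h1
  simpa using this

end Families

/-! ### Lower bounds for the multiplier norms of chirps -/

section Multipliers

open Filter Topology

variable {n : ℕ}

local notation "𝔼" => EuclideanSpace ℝ (Fin n)

theorem multiplierOp_eq_fourierInv {σ : 𝔼 → ℂ} (hσ : σ.HasTemperateGrowth) (f : 𝓢(𝔼, ℂ)) :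
    multiplierOp σ f = (𝓕⁻ (SchwartzMap.smulLeftCLM ℂ σ (𝓕 f)) : 𝓢(𝔼, ℂ)) := by
  funext x
  rw [SchwartzMap.fourierInv_apply_eq_integral, multiplierOp]
  refine integral_congr_ae (.of_forall fun ξ => ?_)
  simp only [SchwartzMap.smulLeftCLM_apply_apply hσ, smul_eq_mul]
  ring

theorem eLpNorm_multiplierOp_le {p : ℝ} {σ : 𝔼 → ℂ} {c : ℝ≥0∞} (h : multiplierNorm p σ < c)
    (f : 𝓢(𝔼, ℂ)) :
    eLpNorm (multiplierOp σ f) (ENNReal.ofReal p) volume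
      ≤ c * eLpNorm f (ENNReal.ofReal p) volume := by
  obtain ⟨c', hc', hlt⟩ := sInf_lt_iff.1 h
  exact (hc' f).trans (mul_le_mul' hlt.le le_rfl)

/-- The chirp is the limit `ε → 0+` of Gaussians with `b = ε - ia`. The dispersive bound is uniform
because `‖b‖ ≥ |a|`. -/
theorem norm_fourierInv_chirp_le {a : ℝ} (ha : a ≠ 0) (c : 𝓢(𝔼, ℂ)) (x : 𝔼) :
    ‖(𝓕⁻ (SchwartzMap.smulLeftCLM ℂ (chirp a) c)) x‖
      ≤ (Real.pi / |a|) ^ (n / 2 : ℝ) * ∫ y, ‖(𝓕⁻ c) y‖ := by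
  rw [SchwartzMap.fourierInv_apply_eq_integral]
  simp only [SchwartzMap.smulLeftCLM_apply_apply (chirp_hasTemperateGrowth a), smul_eq_mul]
  let F : ℝ → 𝔼 → ℂ := fun ε ξ => Complex.exp (-((ε : ℂ) - a * Complex.I) * ‖ξ‖ ^ 2) * c ξ *
    Complex.exp (2 * Real.pi * Complex.I * (inner ℝ x ξ : ℝ))
  have hlim : Tendsto (fun ε => ‖∫ ξ, F ε ξ‖) (𝓝[>] 0) (𝓝 ‖∫ ξ, chirp a ξ * c ξ *
      Complex.exp (2 * Real.pi * Complex.I * (inner ℝ x ξ : ℝ))‖) := by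
    refine (tendsto_integral_filter_of_dominated_convergence (fun ξ => ‖c ξ‖) ?_ ?_
      c.integrable.norm (.of_forall fun ξ => ?_)).norm
    · refine .of_forall fun ε => Continuous.aestronglyMeasurable ?_
      have := c.continuous
      fun_prop
    · filter_upwards [self_mem_nhdsWithin] with ε hε
      refine .of_forall fun ξ => ?_
      simp only [F, norm_mul, norm_exp_two_pi_I_mul, mul_one]
      refine mul_le_of_le_one_left (norm_nonneg _) ?_
      rw [Complex.norm_exp, Real.exp_le_one_iff]
      have e : -((ε : ℂ) - a * Complex.I) * (‖ξ‖ : ℂ) ^ 2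
          = ((-(ε * ‖ξ‖ ^ 2) : ℝ) : ℂ) + ((a * ‖ξ‖ ^ 2 : ℝ) : ℂ) * Complex.I := by
        push_cast; ring
      rw [e, Complex.add_re, Complex.ofReal_re, Complex.re_ofReal_mul, Complex.I_re, mul_zero,
        add_zero, neg_nonpos]
      have : (0 : ℝ) < ε := hε
      positivity
    · have h0 : chirp a ξ * c ξ * Complex.exp (2 * Real.pi * Complex.I * (inner ℝ x ξ : ℝ))
          = F 0 ξ := by
        simp only [F, chirp]
        congr 3
        push_cast
        ring
      rw [h0]
      have hcont : Continuous fun ε : ℝ => F ε ξ := by fun_prop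
      exact (hcont.tendsto 0).mono_left nhdsWithin_le_nhds
  refine le_of_tendsto hlim ?_
  filter_upwards [self_mem_nhdsWithin] with ε hε
  have hb : 0 < ((ε : ℂ) - a * Complex.I).re := by simpa using hε
  have h1 := norm_integral_gaussian_mul_fourier_le hb (𝓕⁻ c) x
  rw [FourierTransform.fourier_fourierInv_eq, finrank_euclideanSpace_fin] at h1
  refine h1.trans ?_
  have him : |a| ≤ ‖(ε : ℂ) - a * Complex.I‖ := by
    have := Complex.abs_im_le_norm ((ε : ℂ) - a * Complex.I)
    simpa using this
  have : 0 < |a| := abs_pos.2 ha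
  gcongr

theorem SchwartzMap.eLpNorm_fourierInv_two (c : 𝓢(𝔼, ℂ)) :
    eLpNorm (𝓕⁻ c : 𝓢(𝔼, ℂ)) 2 volume = eLpNorm c 2 volume := by
  have h := SchwartzMap.norm_fourier_toL2_eq (𝓕⁻ c)
  rw [FourierTransform.fourier_fourierInv_eq, SchwartzMap.norm_toLp, SchwartzMap.norm_toLp] at h
  exact ((ENNReal.toReal_eq_toReal_iff' (c.memLp 2 volume).eLpNorm_ne_top
    ((𝓕⁻ c).memLp 2 volume).eLpNorm_ne_top).1 h).symm

theorem SchwartzMap.eLpNorm_ne_zero {f : 𝓢(𝔼, ℂ)} (hf : f ≠ 0) {p : ℝ≥0∞} (hp : p ≠ 0) :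
    eLpNorm f p volume ≠ 0 := by
  intro h
  rw [eLpNorm_eq_zero_iff f.continuous.aestronglyMeasurable hp] at h
  have h2 : (f : 𝔼 → ℂ) = 0 := (Continuous.ae_eq_iff_eq volume f.continuous continuous_zero).1 h
  exact hf (SchwartzMap.ext fun x => congrFun h2 x)

theorem eLpNorm_rpow_le_of_enorm_le {α : Type*} [MeasurableSpace α] {μ : Measure α} {p q : ℝ}
    (hp : 0 < p) (hpq : p ≤ q) {g : α → ℂ} {A : ℝ≥0∞} (hA : A ≠ ∞) (hg : ∀ x, ‖g x‖ₑ ≤ A) :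
    eLpNorm g (ENNReal.ofReal q) μ ^ q ≤ A ^ (q - p) * eLpNorm g (ENNReal.ofReal p) μ ^ p := by
  have hq : 0 < q := hp.trans_le hpq
  have key : ∀ t : ℝ, 0 < t → eLpNorm g (ENNReal.ofReal t) μ ^ t = ∫⁻ x, ‖g x‖ₑ ^ t ∂μ := by
    intro t ht
    rw [eLpNorm_eq_lintegral_rpow_enorm_toReal (by simpa using ht) ENNReal.ofReal_ne_top,
      ENNReal.toReal_ofReal ht.le, ← ENNReal.rpow_mul, one_div_mul_cancel ht.ne', ENNReal.rpow_one]
  rw [key q hq, key p hp, ← lintegral_const_mul' _ _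
    (ENNReal.rpow_ne_top_of_nonneg (by linarith) hA)]
  refine lintegral_mono fun x => ?_
  have : ‖g x‖ₑ ^ q = ‖g x‖ₑ ^ (q - p) * ‖g x‖ₑ ^ p := by
    rw [← ENNReal.rpow_add_of_nonneg _ _ (by linarith) hp.le, sub_add_cancel]
  rw [this]
  exact mul_le_mul' (ENNReal.rpow_le_rpow (hg x) (by linarith)) le_rfl

theorem nonneg_of_forall_le_rpow {d K : ℝ≥0∞} (hd : d ≠ 0) (hK : K ≠ ∞) {γ : ℝ}
    (h : ∀ N : ℝ, 1 ≤ N → d ≤ K * ENNReal.ofReal (N ^ γ)) : 0 ≤ γ := by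
  by_contra! hγ
  have h1 : Tendsto (fun N : ℝ => N ^ γ) atTop (𝓝 0) := by
    simpa using tendsto_rpow_neg_atTop (y := -γ) (by linarith)
  have h2 : Tendsto (fun N : ℝ => K * ENNReal.ofReal (N ^ γ)) atTop (𝓝 0) := by
    have := ENNReal.Tendsto.const_mul (ENNReal.tendsto_ofReal h1) (.inr hK)
    simpa using this
  have h3 : d ≤ 0 := ge_of_tendsto h2 (by
    filter_upwards [eventually_ge_atTop (1 : ℝ)] with N hN using h N hN)
  exact hd (le_antisymm h3 zero_le)

theorem mul_ofReal_rpow_rpow (K : ℝ≥0∞) {N : ℝ} (hN : 0 < N) (a : ℝ) {t : ℝ} (ht : 0 ≤ t) :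
    (K * ENNReal.ofReal (N ^ a)) ^ t = K ^ t * ENNReal.ofReal (N ^ (a * t)) := by
  rw [ENNReal.mul_rpow_of_nonneg _ _ ht, ENNReal.ofReal_rpow_of_pos (by positivity),
    ← Real.rpow_mul hN.le]

theorem exists_enorm_fourierInv_chirp_le (c : 𝓢(𝔼, ℂ)) :
    ∃ D : ℝ≥0, ∀ a : ℝ, a ≠ 0 → ∀ x, ‖(𝓕⁻ (SchwartzMap.smulLeftCLM ℂ (chirp a) c)) x‖ₑ
      ≤ D * ENNReal.ofReal (|a| ^ (-(n : ℝ) / 2)) := by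
  refine ⟨(Real.pi ^ (n / 2 : ℝ) * ∫ y, ‖(𝓕⁻ c) y‖).toNNReal, fun a ha x => ?_⟩
  have h0 : 0 ≤ ∫ y, ‖(𝓕⁻ c) y‖ := integral_nonneg fun _ => norm_nonneg _
  rw [← ofReal_norm]
  change _ ≤ ENNReal.ofReal _ * _
  rw [← ENNReal.ofReal_mul (by positivity)]
  refine ENNReal.ofReal_le_ofReal ((norm_fourierInv_chirp_le ha c x).trans (le_of_eq ?_))
  rw [Real.div_rpow Real.pi_pos.le (abs_nonneg a), neg_div, Real.rpow_neg (abs_nonneg a)]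
  ring

/-- Uniform `L^p` bounds for the multipliers `exp (i N ‖ξ‖²) ψ(ξ)` restrict the growth rate. -/
theorem mul_abs_le_of_chirp_multiplier_bound {p s : ℝ} (hp : 1 < p) {ψ : 𝓢(𝔼, ℂ)}
    (hψ : ∃ ξ, ψ ξ ≠ 0) {C : ℝ≥0}
    (hC : ∀ N : ℝ, 1 ≤ N → ∀ f : 𝓢(𝔼, ℂ),
      eLpNorm (multiplierOp (fun ξ => chirp N ξ * ψ ξ) f) (ENNReal.ofReal p) volume
        ≤ C * ENNReal.ofReal (N ^ s) * eLpNorm f (ENNReal.ofReal p) volume) :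
    n * |1 / p - 1 / 2| ≤ s := by
  have hp0 : 0 < p := by linarith
  -- One factor `ψ` comes from the symbol, the other from the test function.
  set ψ₂ : 𝓢(𝔼, ℂ) := SchwartzMap.smulLeftCLM ℂ ψ ψ with hψ₂
  have hψ₂_apply : ∀ ξ, ψ₂ ξ = ψ ξ * ψ ξ := fun ξ => by
    rw [hψ₂, SchwartzMap.smulLeftCLM_apply_apply ψ.hasTemperateGrowth, smul_eq_mul]
  have hψ₂0 : ψ₂ ≠ 0 := by
    obtain ⟨ξ, hξ⟩ := hψ
    intro h
    have h1 := hψ₂_apply ξ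
    rw [h] at h1
    exact mul_ne_zero hξ hξ h1.symm
  have hσ : ∀ N : ℝ, (fun ξ : 𝔼 => chirp N ξ * ψ ξ).HasTemperateGrowth := fun N =>
    (chirp_hasTemperateGrowth N).mul ψ.hasTemperateGrowth
  have htwo : (2 : ℝ≥0∞) = ENNReal.ofReal 2 := by simp
  rcases le_total p 2 with hp2 | hp2
  -- For `p ≤ 2` the input is fixed, with transform `ψ`. The output `g` has fixed `L²` norm and sup
  -- norm at most of order `N^{-n/2}`, so `‖g‖₂² ≤ ‖g‖_∞^{2-p} ‖g‖_p^p` forces its `L^p` norm to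
  -- grow.
  · obtain ⟨D, hD⟩ := exists_enorm_fourierInv_chirp_le ψ₂
    have hop : ∀ N : ℝ, multiplierOp (fun ξ => chirp N ξ * ψ ξ) (𝓕⁻ ψ)
        = (𝓕⁻ (SchwartzMap.smulLeftCLM ℂ (chirp N) ψ₂) : 𝓢(𝔼, ℂ)) := by
      intro N
      rw [multiplierOp_eq_fourierInv (hσ N), FourierTransform.fourier_fourierInv_eq]
      congr 2
      refine SchwartzMap.ext fun ξ => ?_
      rw [SchwartzMap.smulLeftCLM_apply_apply (hσ N),
        SchwartzMap.smulLeftCLM_apply_apply (chirp_hasTemperateGrowth N), hψ₂_apply]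
      simp only [smul_eq_mul]
      ring
    have hγ : 0 ≤ -(n : ℝ) / 2 * (2 - p) + s * p := by
      refine nonneg_of_forall_le_rpow (d := eLpNorm ψ₂ 2 volume ^ (2 : ℝ))
        (K := (D : ℝ≥0∞) ^ (2 - p) * (C * eLpNorm (𝓕⁻ ψ : 𝓢(𝔼, ℂ)) (ENNReal.ofReal p) volume) ^ p)
        ?_ ?_ fun N hN => ?_
      · have := SchwartzMap.eLpNorm_ne_zero hψ₂0 (two_ne_zero (α := ℝ≥0∞))
        simp [this]
      · refine ENNReal.mul_ne_top (ENNReal.rpow_ne_top_of_nonneg (by linarith) ENNReal.coe_ne_top)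
          (ENNReal.rpow_ne_top_of_nonneg hp0.le
            (ENNReal.mul_ne_top ENNReal.coe_ne_top ((𝓕⁻ ψ).memLp _ volume).eLpNorm_ne_top))
      · have hN0 : 0 < N := by linarith
        have h1 := hD N hN0.ne'
        rw [abs_of_pos hN0] at h1
        have h2 := eLpNorm_rpow_le_of_enorm_le (μ := (volume : Measure 𝔼)) hp0 hp2
          (by finiteness) h1
        rw [← htwo, SchwartzMap.eLpNorm_fourierInv_two, eLpNorm_smulLeftCLM_chirp,
          mul_ofReal_rpow_rpow _ hN0 _ (by linarith)] at h2
        have h3 := hC N hN (𝓕⁻ ψ)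
        rw [hop, mul_right_comm] at h3
        refine h2.trans ((mul_le_mul' le_rfl (ENNReal.rpow_le_rpow h3 hp0.le)).trans (le_of_eq ?_))
        rw [mul_ofReal_rpow_rpow _ hN0 _ hp0.le, Real.rpow_add hN0,
          ENNReal.ofReal_mul (by positivity)]
        ring
    have h1 : 0 ≤ 1 / p - 1 / 2 := by
      rw [sub_nonneg]; exact one_div_le_one_div_of_le hp0 hp2
    rw [abs_of_nonneg h1]
    have h2 : n * (1 / p - 1 / 2) * p ≤ s * p := by
      have : n * (1 / p - 1 / 2) * p = (n : ℝ) / 2 * (2 - p) := by field_simp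
      rw [this]
      linarith
    exact le_of_mul_le_mul_right h2 hp0
  -- For `p ≥ 2` the roles are reversed: the input carries the conjugate chirp, which the multiplier
  -- undoes. The output is fixed, and the `L^p` norm of the input decays by `‖f‖_p^p ≤ ‖f‖_∞^{p-2}
  -- ‖f‖₂²`.
  · obtain ⟨D, hD⟩ := exists_enorm_fourierInv_chirp_le ψ
    have hop : ∀ N : ℝ, multiplierOp (fun ξ => chirp N ξ * ψ ξ)
        (𝓕⁻ (SchwartzMap.smulLeftCLM ℂ (chirp (-N)) ψ)) = (𝓕⁻ ψ₂ : 𝓢(𝔼, ℂ)) := by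
      intro N
      rw [multiplierOp_eq_fourierInv (hσ N), FourierTransform.fourier_fourierInv_eq]
      congr 2
      refine SchwartzMap.ext fun ξ => ?_
      rw [SchwartzMap.smulLeftCLM_apply_apply (hσ N),
        SchwartzMap.smulLeftCLM_apply_apply (chirp_hasTemperateGrowth (-N)), hψ₂_apply]
      have : chirp N ξ * chirp (-N) ξ = 1 := by
        unfold chirp
        rw [← Complex.exp_add, ← Complex.exp_zero]
        congr 1
        push_cast
        ring
      simp only [smul_eq_mul]
      linear_combination (ψ ξ * ψ ξ) * this
    have hγ : 0 ≤ s * p + -(n : ℝ) / 2 * (p - 2) := by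
      refine nonneg_of_forall_le_rpow (d := eLpNorm (𝓕⁻ ψ₂ : 𝓢(𝔼, ℂ)) (ENNReal.ofReal p) volume ^ p)
        (K := (C : ℝ≥0∞) ^ p * ((D : ℝ≥0∞) ^ (p - 2) * eLpNorm ψ 2 volume ^ (2 : ℝ)))
        ?_ ?_ fun N hN => ?_
      · have h0 : 𝓕⁻ ψ₂ ≠ 0 := by
          intro h
          apply hψ₂0
          have := congrArg (fun k : 𝓢(𝔼, ℂ) => 𝓕 k) h
          simpa using this
        have := SchwartzMap.eLpNorm_ne_zero h0 (p := ENNReal.ofReal p) (by simpa using hp0)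
        simp [this, hp0.le]
      · refine ENNReal.mul_ne_top (ENNReal.rpow_ne_top_of_nonneg hp0.le ENNReal.coe_ne_top)
          (ENNReal.mul_ne_top (ENNReal.rpow_ne_top_of_nonneg (by linarith) ENNReal.coe_ne_top)
          (ENNReal.rpow_ne_top_of_nonneg two_pos.le (ψ.memLp _ volume).eLpNorm_ne_top))
      · have hN0 : 0 < N := by linarith
        have h1 := hD (-N) (by linarith)
        rw [abs_neg, abs_of_pos hN0] at h1
        have h2 := eLpNorm_rpow_le_of_enorm_le (μ := (volume : Measure 𝔼)) two_pos hp2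
          (by finiteness) h1
        rw [← htwo, SchwartzMap.eLpNorm_fourierInv_two, eLpNorm_smulLeftCLM_chirp,
          mul_ofReal_rpow_rpow _ hN0 _ (by linarith)] at h2
        have h3 := hC N hN (𝓕⁻ (SchwartzMap.smulLeftCLM ℂ (chirp (-N)) ψ))
        rw [hop] at h3
        refine (ENNReal.rpow_le_rpow h3 hp0.le).trans ?_
        rw [ENNReal.mul_rpow_of_nonneg _ _ hp0.le]
        refine (mul_le_mul' le_rfl h2).trans (le_of_eq ?_)
        rw [mul_ofReal_rpow_rpow _ hN0 _ hp0.le, Real.rpow_add hN0,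
          ENNReal.ofReal_mul (by positivity)]
        ring
    have h1 : 1 / p - 1 / 2 ≤ 0 := by
      rw [sub_nonpos]; exact one_div_le_one_div_of_le two_pos hp2
    rw [abs_of_nonpos h1]
    have h2 : n * (-(1 / p - 1 / 2)) * p ≤ s * p := by
      have : n * (-(1 / p - 1 / 2)) * p = (n : ℝ) / 2 * (p - 2) := by field_simp; ring
      rw [this]
      linarith
    exact le_of_mul_le_mul_right h2 hp0

end Multipliers

/-! ### Multiplier norms dominate the values of the symbol -/

section LowerBound

open Filter Topology

variable {n : ℕ}

local notation "𝔼" => EuclideanSpace ℝ (Fin n)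

/-- The Schwartz function `ξ ↦ G (δ⁻¹ (ξ - ξ₀))`. -/
noncomputable def SchwartzMap.dilateTranslate {δ : ℝ} (hδ : δ ≠ 0) (ξ₀ : 𝔼) (G : 𝓢(𝔼, ℂ)) :
    𝓢(𝔼, ℂ) :=
  SchwartzMap.compSubConstCLM ℂ ξ₀ (SchwartzMap.compCLMOfContinuousLinearEquiv ℂ
    (ContinuousLinearEquiv.smulLeft (Units.mk0 δ⁻¹ (inv_ne_zero hδ)) : 𝔼 ≃L[ℝ] 𝔼) G)

theorem SchwartzMap.dilateTranslate_apply {δ : ℝ} (hδ : δ ≠ 0) (ξ₀ : 𝔼) (G : 𝓢(𝔼, ℂ)) (ξ : 𝔼) :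
    SchwartzMap.dilateTranslate hδ ξ₀ G ξ = G (δ⁻¹ • (ξ - ξ₀)) := rfl

theorem integral_eq_pow_mul_integral_comp_affine {δ : ℝ} (hδ : 0 < δ) (ξ₀ : 𝔼) (H : 𝔼 → ℂ) :
    ∫ ξ, H ξ = (δ : ℂ) ^ n * ∫ η, H (δ • η + ξ₀) := by
  rw [Measure.integral_comp_smul_of_nonneg volume (fun η => H (η + ξ₀)) δ (hR := hδ.le),
    integral_add_right_eq_self, finrank_euclideanSpace_fin, Complex.real_smul, ← mul_assoc]
  push_cast
  rw [mul_inv_cancel₀ (by exact_mod_cast (pow_pos hδ n).ne'), one_mul]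

theorem multiplierOp_dilateTranslate {δ : ℝ} (hδ : 0 < δ) (ξ₀ : 𝔼) (τ : 𝔼 → ℂ) (F : 𝓢(𝔼, ℂ))
    (x : 𝔼) :
    multiplierOp τ (𝓕⁻ (SchwartzMap.dilateTranslate hδ.ne' ξ₀ (𝓕 F))) x =
      ((δ : ℂ) ^ n * Complex.exp (2 * Real.pi * Complex.I * (inner ℝ x ξ₀ : ℝ))) *
        multiplierOp (fun η => τ (δ • η + ξ₀)) F (δ • x) := by
  rw [multiplierOp, FourierTransform.fourier_fourierInv_eq,
    integral_eq_pow_mul_integral_comp_affine hδ ξ₀, multiplierOp,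
    mul_assoc ((δ : ℂ) ^ n) (Complex.exp _)]
  congr 1
  rw [← integral_const_mul]
  refine integral_congr_ae (.of_forall fun η => ?_)
  simp only [SchwartzMap.dilateTranslate_apply, add_sub_cancel_right, smul_smul,
    inv_mul_cancel₀ hδ.ne', one_smul, inner_add_right, inner_smul_right, real_inner_smul_left]
  have : Complex.exp (2 * Real.pi * Complex.I * ((δ * inner ℝ x η + inner ℝ x ξ₀ : ℝ) : ℂ))
      = Complex.exp (2 * Real.pi * Complex.I * (inner ℝ x ξ₀ : ℝ)) *
        Complex.exp (2 * Real.pi * Complex.I * ((δ * inner ℝ x η : ℝ) : ℂ)) := by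
    rw [← Complex.exp_add]
    congr 1
    push_cast
    ring
  rw [this]
  ring

theorem multiplierOp_one (f : 𝓢(𝔼, ℂ)) : multiplierOp (fun _ => 1) f = f := by
  funext x
  simp only [multiplierOp, mul_one]
  exact (f.apply_eq_integral_fourier x).symm

theorem eLpNorm_comp_smul {p : ℝ≥0∞} (hp : p ≠ ∞) {δ : ℝ} (hδ : 0 < δ) (K : 𝔼 → ℂ) :
    eLpNorm (fun x => K (δ • x)) p volume
      = ENNReal.ofReal (δ ^ n)⁻¹ ^ (1 / p).toReal * eLpNorm K p volume := by
  have h := (Homeomorph.smulOfNeZero δ hδ.ne' : 𝔼 ≃ₜ 𝔼).measurableEmbedding.eLpNorm_map_measure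
    (g := K) (p := p) (μ := volume)
  have hmap : Measure.map (Homeomorph.smulOfNeZero δ hδ.ne' : 𝔼 ≃ₜ 𝔼) volume
      = ENNReal.ofReal (δ ^ n)⁻¹ • volume := by
    have := Measure.map_addHaar_smul (volume : Measure 𝔼) hδ.ne'
    rw [finrank_euclideanSpace_fin, abs_of_pos (by positivity)] at this
    exact this
  rw [hmap, eLpNorm_smul_measure_of_ne_top hp, smul_eq_mul] at h
  exact h.symm

theorem eLpNorm_modulation_mul_comp_smul {p : ℝ≥0∞} (hp : p ≠ ∞) {δ : ℝ} (hδ : 0 < δ) (ξ₀ : 𝔼)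
    (K : 𝔼 → ℂ) :
    eLpNorm (fun x => ((δ : ℂ) ^ n * Complex.exp (2 * Real.pi * Complex.I * (inner ℝ x ξ₀ : ℝ))) *
        K (δ • x)) p volume
      = ENNReal.ofReal (δ ^ n) * ENNReal.ofReal (δ ^ n)⁻¹ ^ (1 / p).toReal *
        eLpNorm K p volume := by
  have h1 : eLpNorm (fun x => ((δ : ℂ) ^ n *
      Complex.exp (2 * Real.pi * Complex.I * (inner ℝ x ξ₀ : ℝ))) * K (δ • x)) p volume
      = eLpNorm ((δ : ℂ) ^ n • fun x => K (δ • x)) p volume := by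
    refine eLpNorm_congr_norm_ae (.of_forall fun x => ?_)
    simp [norm_exp_two_pi_I_mul]
  rw [h1, eLpNorm_const_smul, eLpNorm_comp_smul hp hδ, ← mul_assoc]
  congr 2
  rw [← Complex.ofReal_pow, ← ofReal_norm, Complex.norm_real, Real.norm_eq_abs,
    abs_of_pos (by positivity)]

/-- Multiplier bounds are invariant under affine changes of the frequency variable. -/
theorem eLpNorm_multiplierOp_comp_affine_le {p c : ℝ≥0∞} (hp : p ≠ ∞) {τ : 𝔼 → ℂ}
    (h : ∀ f : 𝓢(𝔼, ℂ), eLpNorm (multiplierOp τ f) p volume ≤ c * eLpNorm f p volume)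
    {δ : ℝ} (hδ : 0 < δ) (ξ₀ : 𝔼) (F : 𝓢(𝔼, ℂ)) :
    eLpNorm (multiplierOp (fun η => τ (δ • η + ξ₀)) F) p volume ≤ c * eLpNorm F p volume := by
  set f : 𝓢(𝔼, ℂ) := 𝓕⁻ (SchwartzMap.dilateTranslate hδ.ne' ξ₀ (𝓕 F)) with hf
  have h1 := h f
  have e1 : multiplierOp τ f = fun x => ((δ : ℂ) ^ n *
      Complex.exp (2 * Real.pi * Complex.I * (inner ℝ x ξ₀ : ℝ))) *
        multiplierOp (fun η => τ (δ • η + ξ₀)) F (δ • x) :=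
    funext fun x => multiplierOp_dilateTranslate hδ ξ₀ τ F x
  have e2 : (f : 𝔼 → ℂ) = fun x => ((δ : ℂ) ^ n *
      Complex.exp (2 * Real.pi * Complex.I * (inner ℝ x ξ₀ : ℝ))) * F (δ • x) := by
    -- The same change of variables with the symbol `1` describes `f` itself, so input and output
    -- carry the same scaling factor, which cancels.
    rw [← multiplierOp_one f]
    funext x
    rw [hf, multiplierOp_dilateTranslate hδ ξ₀ _ F x, multiplierOp_one]
  rw [e1, e2, eLpNorm_modulation_mul_comp_smul hp hδ, eLpNorm_modulation_mul_comp_smul hp hδ,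
    mul_left_comm] at h1
  have hpos : 0 < δ ^ n := by positivity
  refine (ENNReal.mul_le_mul_iff_right ?_ ?_).1 h1
  · refine mul_ne_zero (by simpa using hpos) ?_
    exact (ENNReal.rpow_pos (by simpa using hpos) ENNReal.ofReal_ne_top).ne'
  · exact ENNReal.mul_ne_top ENNReal.ofReal_ne_top
      (ENNReal.rpow_ne_top_of_nonneg ENNReal.toReal_nonneg ENNReal.ofReal_ne_top)

/-- The `L^p` multiplier norm dominates the values of a smooth symbol. -/
theorem enorm_apply_le_of_multiplier_bound {p c : ℝ≥0∞} (hp0 : p ≠ 0) (hp : p ≠ ∞)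
    {τ : 𝓢(𝔼, ℂ)}
    (h : ∀ f : 𝓢(𝔼, ℂ), eLpNorm (multiplierOp τ f) p volume ≤ c * eLpNorm f p volume)
    {F : 𝓢(𝔼, ℂ)} (hF : F ≠ 0) (ξ₀ : 𝔼) : ‖τ ξ₀‖ₑ ≤ c := by
  -- As `δ → 0` the rescaled symbols `τ(δη + ξ₀)` tend to the constant `τ(ξ₀)` while their operator
  -- bounds stay at most `c`. Fatou's lemma carries the bound to multiplication by `τ(ξ₀)`.
  set δ : ℕ → ℝ := fun k => 1 / ((k : ℝ) + 1) with hδ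
  have hδpos : ∀ k, 0 < δ k := fun k => by positivity
  have hδlim : Tendsto δ atTop (𝓝 0) := tendsto_one_div_add_atTop_nhds_zero_nat
  have htemp : ∀ k, (fun η : 𝔼 => τ (δ k • η + ξ₀)).HasTemperateGrowth := by
    intro k
    have h2 : Function.HasTemperateGrowth (fun η : 𝔼 => δ k • η + ξ₀) := by fun_prop
    exact τ.hasTemperateGrowth.comp h2
  have hmeas : ∀ k, AEStronglyMeasurable (multiplierOp (fun η => τ (δ k • η + ξ₀)) F) volume := by
    intro k
    rw [multiplierOp_eq_fourierInv (htemp k)]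
    exact (SchwartzMap.continuous _).aestronglyMeasurable
  have hlim : ∀ x, Tendsto (fun k => multiplierOp (fun η => τ (δ k • η + ξ₀)) F x) atTop
      (𝓝 (τ ξ₀ * F x)) := by
    intro x
    rw [F.apply_eq_integral_fourier x, ← integral_const_mul]
    obtain ⟨S, hS⟩ : ∃ S, ∀ ξ, ‖τ ξ‖ ≤ S := ⟨_, SchwartzMap.norm_le_seminorm ℝ τ⟩
    refine tendsto_integral_of_dominated_convergence (fun ξ => ‖(𝓕 F) ξ‖ * S) (fun k => ?_)
      ((𝓕 F).integrable.norm.mul_const S) (fun k => .of_forall fun ξ => ?_)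
      (.of_forall fun ξ => ?_)
    · have h1 := (𝓕 F).continuous
      have h2 := τ.continuous
      exact Continuous.aestronglyMeasurable (by fun_prop)
    · rw [norm_mul, norm_mul, norm_exp_two_pi_I_mul, mul_one]
      exact mul_le_mul_of_nonneg_left (hS _) (norm_nonneg _)
    · have h2 := τ.continuous
      have hcont : Continuous fun t : ℝ => (𝓕 F) ξ * τ (t • ξ + ξ₀) *
          Complex.exp (2 * Real.pi * Complex.I * (inner ℝ x ξ : ℝ)) := by fun_prop
      have := (hcont.tendsto 0).comp hδlim
      simp only [zero_smul, zero_add] at this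
      convert! this using 2
      ring
  have hliminf := Lp.eLpNorm_lim_le_liminf_eLpNorm (p := p) hmeas (fun x => τ ξ₀ * F x)
    (.of_forall hlim)
  have hle : eLpNorm (fun x => τ ξ₀ * F x) p volume ≤ c * eLpNorm F p volume := by
    refine hliminf.trans ?_
    refine (liminf_le_liminf (.of_forall fun k =>
      eLpNorm_multiplierOp_comp_affine_le hp h (hδpos k) ξ₀ F)).trans ?_
    rw [liminf_const]
  have e : eLpNorm (fun x => τ ξ₀ * F x) p volume = ‖τ ξ₀‖ₑ * eLpNorm F p volume :=
    eLpNorm_const_smul (τ ξ₀) (F : 𝔼 → ℂ) p volume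
  rw [e] at hle
  exact (ENNReal.mul_le_mul_iff_left (SchwartzMap.eLpNorm_ne_zero hF hp0)
    (F.memLp p volume).eLpNorm_ne_top).1 hle

end LowerBound

/-! ### The two necessary conditions -/

/-- A Hörmander type inequality turns growth of Hörmander norms into growth of operator norms. -/
theorem exists_eLpNorm_multiplierOp_le {n : ℕ} {p r s γ : ℝ}
    {Ψ : 𝓢(EuclideanSpace ℝ (Fin n), ℂ)}
    (hbound : ∃ C : ℝ≥0, ∀ σ : EuclideanSpace ℝ (Fin n) → ℂ, MemLp σ ∞ volume →
      hormanderNorm Ψ r s σ < ∞ → multiplierNorm p σ ≤ C * hormanderNorm Ψ r s σ)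
    {e : ℝ → EuclideanSpace ℝ (Fin n) → ℂ} (he : ∀ N, MemLp (e N) ∞ volume)
    (hC : ∃ C : ℝ≥0, ∀ N : ℝ, 1 ≤ N → hormanderNorm Ψ r s (e N) ≤ C * ENNReal.ofReal (N ^ γ)) :
    ∃ C : ℝ≥0, ∀ N : ℝ, 1 ≤ N → ∀ f : 𝓢(EuclideanSpace ℝ (Fin n), ℂ),
      eLpNorm (multiplierOp (e N) f) (ENNReal.ofReal p) volume
        ≤ C * ENNReal.ofReal (N ^ γ) * eLpNorm f (ENNReal.ofReal p) volume := by
  obtain ⟨C₁, hC₁⟩ := hbound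
  obtain ⟨C₂, hC₂⟩ := hC
  -- The `+ 1` makes the constant strictly larger than the multiplier norm. As that norm is an
  -- infimum, some admissible constant then lies below it.
  refine ⟨C₁ * C₂ + 1, fun N hN f => eLpNorm_multiplierOp_le ?_ f⟩
  have hN0 : 0 < N ^ γ := Real.rpow_pos_of_pos (by linarith) γ
  have h1 : hormanderNorm Ψ r s (e N) < ∞ :=
    (hC₂ N hN).trans_lt (ENNReal.mul_lt_top ENNReal.coe_lt_top ENNReal.ofReal_lt_top)
  calc multiplierNorm p (e N) ≤ C₁ * (C₂ * ENNReal.ofReal (N ^ γ)) :=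
        (hC₁ _ (he N) h1).trans (mul_le_mul' le_rfl (hC₂ N hN))
    _ < C₁ * (C₂ * ENNReal.ofReal (N ^ γ)) + ENNReal.ofReal (N ^ γ) :=
        ENNReal.lt_add_right (by finiteness) (by simpa using hN0)
    _ = ((C₁ * C₂ + 1 : ℝ≥0) : ℝ≥0∞) * ENNReal.ofReal (N ^ γ) := by
        push_cast
        ring

theorem SchwartzMap.coe_smulLeftCLM_eq_mul {n : ℕ} {e : EuclideanSpace ℝ (Fin n) → ℂ}
    (he : e.HasTemperateGrowth) (φ : 𝓢(EuclideanSpace ℝ (Fin n), ℂ)) :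
    (SchwartzMap.smulLeftCLM ℂ e φ : EuclideanSpace ℝ (Fin n) → ℂ) = fun ξ => e ξ * φ ξ := by
  funext ξ
  rw [SchwartzMap.smulLeftCLM_apply_apply he, smul_eq_mul]

theorem Function.HasTemperateGrowth.memLp_top_mul {n : ℕ} {e : EuclideanSpace ℝ (Fin n) → ℂ}
    (he : e.HasTemperateGrowth) (φ : 𝓢(EuclideanSpace ℝ (Fin n), ℂ)) :
    MemLp (fun ξ => e ξ * φ ξ) ∞ volume := by
  rw [← SchwartzMap.coe_smulLeftCLM_eq_mul he]
  exact SchwartzMap.memLp _ ∞ volume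

theorem IsDyadicPartition.natCast_le_mul {n : ℕ} {p r s : ℝ} (hp : 1 < p) (hr : 1 < r)
    (hs : 0 < s) {Ψ : 𝓢(EuclideanSpace ℝ (Fin n), ℂ)} (hΨ : IsDyadicPartition Ψ)
    {ξ₀ : EuclideanSpace ℝ (Fin n)} (hξ₀ : ‖ξ₀‖ = 1)
    (hbound : ∃ C : ℝ≥0, ∀ σ : EuclideanSpace ℝ (Fin n) → ℂ, MemLp σ ∞ volume →
      hormanderNorm Ψ r s σ < ∞ → multiplierNorm p σ ≤ C * hormanderNorm Ψ r s σ) :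
    (n : ℝ) ≤ r * s := by
  have hΨ₀ : (𝓕 Ψ) ξ₀ = 1 := hΨ.fourier_eq_one hξ₀
  -- Any Schwartz function with value `1` at the origin would do; a translate of `Ψ̂` is at hand.
  obtain ⟨φ, hφ⟩ : ∃ φ : 𝓢(EuclideanSpace ℝ (Fin n), ℂ), φ 0 = 1 :=
    ⟨SchwartzMap.compSubConstCLM ℂ (-ξ₀) (𝓕 Ψ), by
      rw [SchwartzMap.compSubConstCLM_apply, zero_sub, neg_neg, hΨ₀]⟩
  have hΨne : Ψ ≠ 0 := by
    intro h
    have h0 : 𝓕 Ψ = 0 := by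
      rw [h]
      exact map_zero (FourierTransform.fourierCLM ℂ 𝓢(EuclideanSpace ℝ (Fin n), ℂ))
    rw [h0] at hΨ₀
    exact zero_ne_one hΨ₀
  have htemp : ∀ N : ℝ, (fun ξ => φ (N • (ξ - ξ₀))).HasTemperateGrowth := by
    intro N
    simpa using hasTemperateGrowth_comp_affine φ N 1 ξ₀
  have hnorm : ∃ C : ℝ≥0, ∀ N : ℝ, 1 ≤ N →
      hormanderNorm Ψ r s (fun ξ => φ (N • (ξ - ξ₀)) * (𝓕 Ψ) ξ)
        ≤ C * ENNReal.ofReal (N ^ (s - n / r)) :=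
    hΨ.exists_hormanderNorm_le (fun N ξ => φ (N • (ξ - ξ₀)))
      fun μ hμ c => exists_sobolevNorm_bump_le hr hs hμ ξ₀ φ c
  have hmem : ∀ N, MemLp ((fun N ξ => φ (N • (ξ - ξ₀)) * (𝓕 Ψ) ξ :
      ℝ → EuclideanSpace ℝ (Fin n) → ℂ) N) ∞ volume := fun N => (htemp N).memLp_top_mul (𝓕 Ψ)
  obtain ⟨C, hC⟩ := exists_eLpNorm_multiplierOp_le hbound hmem hnorm
  have hγ : 0 ≤ s - n / r := by
    refine nonneg_of_forall_le_rpow (d := 1) (K := C) one_ne_zero ENNReal.coe_ne_top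
      fun N hN => ?_
    have h1 := enorm_apply_le_of_multiplier_bound (p := ENNReal.ofReal p)
      (by simpa using one_pos.trans hp) ENNReal.ofReal_ne_top
      (τ := SchwartzMap.smulLeftCLM ℂ (fun ξ => φ (N • (ξ - ξ₀))) (𝓕 Ψ))
      (by
        rw [SchwartzMap.coe_smulLeftCLM_eq_mul (htemp N)]
        exact hC N hN) hΨne ξ₀
    rw [SchwartzMap.smulLeftCLM_apply_apply (htemp N), sub_self, smul_zero, hφ, hΨ₀] at h1
    simpa using h1
  rw [sub_nonneg, div_le_iff₀ (one_pos.trans hr)] at hγ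
  linarith

theorem IsDyadicPartition.mul_abs_le {n : ℕ} {p r s : ℝ} (hp : 1 < p) (hr : 1 < r)
    (hs : 0 < s) {Ψ : 𝓢(EuclideanSpace ℝ (Fin n), ℂ)} (hΨ : IsDyadicPartition Ψ)
    {ξ₀ : EuclideanSpace ℝ (Fin n)} (hξ₀ : ‖ξ₀‖ = 1)
    (hbound : ∃ C : ℝ≥0, ∀ σ : EuclideanSpace ℝ (Fin n) → ℂ, MemLp σ ∞ volume →
      hormanderNorm Ψ r s σ < ∞ → multiplierNorm p σ ≤ C * hormanderNorm Ψ r s σ) :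
    n * |1 / p - 1 / 2| ≤ s := by
  have hnorm : ∃ C : ℝ≥0, ∀ N : ℝ, 1 ≤ N →
      hormanderNorm Ψ r s (fun ξ => chirp N ξ * (𝓕 Ψ) ξ) ≤ C * ENNReal.ofReal (N ^ s) := by
    refine hΨ.exists_hormanderNorm_le (fun N ξ => chirp N ξ) fun μ _ c => ?_
    -- Dilating by `μ` multiplies the chirp rate by `μ²`, which is the role of the parameter `lam`.
    simp only [chirp_smul]
    exact exists_sobolevNorm_chirp_le hr hs (μ ^ 2) c
  have hmem : ∀ N, MemLp ((fun N ξ => chirp N ξ * (𝓕 Ψ) ξ :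
      ℝ → EuclideanSpace ℝ (Fin n) → ℂ) N) ∞ volume :=
    fun N => (chirp_hasTemperateGrowth N).memLp_top_mul (𝓕 Ψ)
  obtain ⟨C, hC⟩ := exists_eLpNorm_multiplierOp_le hbound hmem hnorm
  refine mul_abs_le_of_chirp_multiplier_bound hp (ψ := 𝓕 Ψ) ⟨ξ₀, ?_⟩ hC
  rw [hΨ.fourier_eq_one hξ₀]
  exact one_ne_zero

theorem proposition4p1 (n : ℕ) (hn : 1 ≤ n) (p r s : ℝ) (hp : 1 < p) (hr : 1 < r) (hs : 0 < s)
    (Ψ : 𝓢(EuclideanSpace ℝ (Fin n), ℂ)) (hΨ : IsDyadicPartition Ψ)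
    (hbound : ∃ C : ℝ≥0, ∀ σ : EuclideanSpace ℝ (Fin n) → ℂ, MemLp σ ∞ volume →
      hormanderNorm Ψ r s σ < ∞ → multiplierNorm p σ ≤ C * hormanderNorm Ψ r s σ) :
    (n : ℝ) ≤ r * s ∧ |1 / p - 1 / 2| ≤ s / n := by
  have hn0 : (0 : ℝ) < n := by exact_mod_cast hn
  -- A unit vector exists because `n ≥ 1`; `Ψ̂` equals `1` there.
  set ξ₀ : EuclideanSpace ℝ (Fin n) := EuclideanSpace.single ⟨0, hn⟩ (1 : ℝ) with hξ₀
  have hξ₀_norm : ‖ξ₀‖ = 1 := by simp [hξ₀]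
  refine ⟨hΨ.natCast_le_mul hp hr hs hξ₀_norm hbound, ?_⟩
  rw [le_div_iff₀ hn0, mul_comm]
  exact hΨ.mul_abs_le hp hr hs hξ₀_norm hbound
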